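/- Let $n\ge 2$ and let $\mathcal G=so(2n,\mathbb C)$ be the Lie subalgebra of $gl(2n,\mathbb C)$ spanned by $E_{i,j}-E_{n+j,n+i}$ $(1\le i,j\le n)$ and $E_{i,n+j}-E_{j,n+i}$, $E_{n+j,i}-E_{n+i,j}$ $(1\le i<j\le n)$. It acts on $\mathcal A=\mathbb C[x_1,\dots,x_{2n}]$ by restriction of the representation of $gl(2n,\mathbb C)$ given, for $1\le i,j\le n$, by $$E_{i,j}\mapsto -x_j\partial_{x_i}-\delta_{i,j},\quad E_{i,n+j}\mapsto \partial_{x_i}\partial_{x_{n+j}},\quad E_{n+i,j}\mapsto -x_{n+i}x_j,\quad E_{n+i,n+j}\mapsto x_{n+i}\partial_{x_{n+j}}.$$ Let $H=\sum_{i}\mathbb C(E_{i,i}-E_{n+i,n+i})$ be the Cartan subalgebra, let the positive root vectors be $E_{i,j}-E_{n+j,n+i}$ and $E_{i,n+j}-E_{j,n+i}$ for $1\le i<j\le n$, and let $\lambda_1,\dots,\lambda_n\in H^*$ be the fundamental weights, $\lambda_i(h_j)=\delta_{i,j}$, where $h_i=E_{i,i}-E_{n+i,n+i}-E_{i+1,i+1}+E_{n+i+1,n+i+1}$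 for $i<n$ and $h_n=E_{n-1,n-1}-E_{2n-1,2n-1}+E_{n,n}-E_{2n,2n}$. For $k\in\mathbb Z$ let $\mathcal A_{\langle k\rangle}$ be the span of the monomials $x^\alpha$ with $\sum_{i=1}^n\alpha_{n+i}-\sum_{i=1}^n\alpha_i=k$. Put $$\Delta=-\sum_{i=1}^n x_i\partial_{x_{n+i}},\qquad \eta=\sum_{i=1}^n x_{n+i}\partial_{x_i},$$ $\mathcal H_{\langle k\rangle}=\{f\in\mathcal A_{\langle k\rangle}\mid\Delta f=0\}$ and $\mathcal H'_{\langle k\rangle}=\{f\in\mathcal A_{\langle k\rangle}\mid\eta f=0\}$. **Theorem.** (1) Let $k\ge 0$. Then $\mathcal A_{\langle k\rangle}=\mathcal H'_{\langle k\rangle}\oplus\Delta\mathcal A_{\langle k+2\rangle}$ as $\mathcal G$-modules, and $\mathcal H'_{\langle k\rangle}$ is an irreducible highest weight $\mathcal G$-module with highest weight $k\lambda_{n-1}-(k+2)\lambda_n$ and a highest weight vector $x_{2n}^k$. Moreover, the polynomials $$\prod_{t=1}^n x_{n+t}^{k_t}\prod_{1\le i<j\le n}(x_ix_{n+j}-x_jx_{n+i})^{k_{i,j}},$$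 where $k_t,k_{i,j}\in\mathbb N$ (with $0\in\mathbb N$) satisfy $\sum_{t=1}^n k_t=k$, $k_{i,j}k_t=0$ for $i<j<t$, and $k_{i,j}k_{i_1,j_1}=0$ for $i<i_1$ and $j>j_1$ (where $i<j$ and $i_1<j_1$), are linearly independent, distinct exponents being counted separately, and form a basis of $\mathcal H'_{\langle k\rangle}$. (2) Let $k<0$. Then $\mathcal A_{\langle k\rangle}=\mathcal H_{\langle k\rangle}\oplus\eta\mathcal A_{\langle k-2\rangle}$ as $\mathcal G$-modules, and $\mathcal H_{\langle k\rangle}$ is an irreducible highest weight $\mathcal G$-module with highest weight $-k\lambda_{n-1}+(k-2)\lambda_n$ and a highest weight vector $x_n^{-k}$. Moreover, the polynomials $$\prod_{t=1}^n x_t^{k_t}\prod_{1\le i<j\le n}(x_ix_{n+j}-x_jx_{n+i})^{k_{i,j}},$$ where $k_t,k_{i,j}\in\mathbb N$ satisfy $\sum_{t=1}^n k_t=-k$, $k_{i,j}k_t=0$ for $i<j<t$, and $k_{i,j}k_{i_1,j_1}=0$ for $i<i_1$ and $j>j_1$, are linearly independent in the same sense and form a basis of $\mathcal H_{\langle k\rangle}$.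 -/

import Mathlib

-- Associative algebras are Lie algebras under the commutator (Mathlib keeps this instance local).
attribute [local instance 100] LieRing.ofAssociativeRing

namespace SoPoly

noncomputable section

/-- The index set of the `2n` variables: `Sum.inl i` stands for the index `i` and `Sum.inr i` for
the index `n + i` (with `i` running over `Fin n`, i.e. shifted by one). -/
abbrev Idx (n : ℕ) : Type := Fin n ⊕ Fin n

/-- The polynomial algebra `𝓐 = ℂ[x₁, …, x₂ₙ]`. -/
abbrev Poly (n : ℕ) : Type := MvPolynomial (Idx n) ℂ

/- The three instances below only fix the path by which Lean finds the usual additive group and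
`ℂ`-module structures on `𝓐` (through its structure of commutative `ℂ`-algebra). -/
instance (priority := 2000) instAddCommGroupPoly {n : ℕ} : AddCommGroup (Poly n) :=
  Ring.toAddCommGroup

instance (priority := 2000) instAddCommMonoidPoly {n : ℕ} : AddCommMonoid (Poly n) :=
  instAddCommGroupPoly.toAddCommMonoid

instance (priority := 2000) instModulePoly {n : ℕ} : Module ℂ (Poly n) :=
  Algebra.toModule

/-- The Lie algebra `gl(2n, ℂ)`. -/
abbrev Gl (n : ℕ) : Type := Matrix (Idx n) (Idx n) ℂ

/-- The Lie algebra `so(2n, ℂ)`: the matrices skew-adjoint for the form with matrix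
`[[0, 1], [1, 0]]`, that is the span of `E_{i,j} - E_{n+j,n+i}`, `E_{i,n+j} - E_{j,n+i}` and
`E_{n+j,i} - E_{n+i,j}`. -/
abbrev so (n : ℕ) : LieSubalgebra ℂ (Gl n) := LieAlgebra.Orthogonal.typeD (Fin n) ℂ

/-- The matrix unit `E_{a,b}`. -/
def E {n : ℕ} (a b : Idx n) : Gl n := Matrix.single a b 1

/-! ### The operators and the representation -/

/-- Multiplication by the variable `x_a`. -/
def mulX {n : ℕ} (a : Idx n) : Module.End ℂ (Poly n) :=
  LinearMap.mulLeft ℂ (MvPolynomial.X a)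

/-- The partial derivative `∂_{x_a}`. -/
def dX {n : ℕ} (a : Idx n) : Module.End ℂ (Poly n) :=
  (MvPolynomial.pderiv a).toLinearMap

/-- The operator by which `E_{a,b}` acts on `𝓐` after the swap `-x_i ↔ ∂_{x_i}` for the
indices `i = 1, …, n`. Multiplication of operators is composition. -/
def opE {n : ℕ} : Idx n → Idx n → Module.End ℂ (Poly n)
  | .inl i, .inl j => -(mulX (.inl j) * dX (.inl i)) - (if i = j then 1 else 0)
  | .inl i, .inr j => dX (.inl i) * dX (.inr j)
  | .inr i, .inl j => -(mulX (.inr i) * mulX (.inl j))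
  | .inr i, .inr j => mulX (.inr i) * dX (.inr j)

/-- Auxiliary factor: `opE a b = opP a * opQ b`. -/
def opP {n : ℕ} : Idx n → Module.End ℂ (Poly n)
  | .inl i => dX (.inl i)
  | .inr i => mulX (.inr i)

/-- Auxiliary factor: `opE a b = opP a * opQ b`. -/
def opQ {n : ℕ} : Idx n → Module.End ℂ (Poly n)
  | .inl i => -mulX (.inl i)
  | .inr i => dX (.inr i)

theorem mulX_apply {n : ℕ} (a : Idx n) (f : Poly n) : mulX a f = MvPolynomial.X a * f := rfl

theorem dX_apply {n : ℕ} (a : Idx n) (f : Poly n) : dX a f = MvPolynomial.pderiv a f := rfl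

theorem mulX_comm {n : ℕ} (a b : Idx n) : mulX a * mulX b = mulX b * mulX a := by
  refine LinearMap.ext fun f => ?_
  simp only [mulX, Module.End.mul_apply, LinearMap.mulLeft_apply]
  ring

theorem dX_comm {n : ℕ} (a b : Idx n) : dX a * dX b = dX b * dX a := by
  refine LinearMap.ext fun f => ?_
  change MvPolynomial.pderiv a (MvPolynomial.pderiv b f)
    = MvPolynomial.pderiv b (MvPolynomial.pderiv a f)
  induction f using MvPolynomial.induction_on with
  | C c => simp
  | add p q hp hq => simp only [map_add, hp, hq]
  | mul_X p i hp =>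
    have h (a b : Idx n) : MvPolynomial.pderiv a (MvPolynomial.pderiv b (MvPolynomial.X i)) =
        (0 : Poly n) := by
      rw [MvPolynomial.pderiv_X, Pi.single_apply]
      split_ifs <;> simp
    simp only [MvPolynomial.pderiv_mul, map_add, hp, h]
    ring

theorem dX_mulX {n : ℕ} (a b : Idx n) :
    dX a * mulX b = mulX b * dX a + (if a = b then 1 else 0) := by
  refine LinearMap.ext fun f => ?_
  rw [LinearMap.add_apply, Module.End.mul_apply, Module.End.mul_apply, mulX_apply, mulX_apply,
    dX_apply, dX_apply, MvPolynomial.pderiv_mul, MvPolynomial.pderiv_X, Pi.single_apply]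
  by_cases h : a = b
  · simp [h, add_comm]
  · simp [h, Ne.symm h]

theorem opE_eq {n : ℕ} (a b : Idx n) : opE a b = opP a * opQ b := by
  rcases a with i | i <;> rcases b with j | j <;>
    simp only [opE, opP, opQ, mul_neg, dX_mulX, Sum.inl.injEq]
  abel

theorem opP_comm {n : ℕ} (a b : Idx n) : opP a * opP b = opP b * opP a := by
  rcases a with i | i <;> rcases b with j | j <;>
    simp [opP, dX_comm (Sum.inl i), mulX_comm (Sum.inr i), dX_mulX]

theorem opQ_comm {n : ℕ} (a b : Idx n) : opQ a * opQ b = opQ b * opQ a := by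
  rcases a with i | i <;> rcases b with j | j <;>
    simp [opQ, dX_comm (Sum.inr i), mulX_comm (Sum.inl i), dX_mulX]

theorem opQ_opP {n : ℕ} (a b : Idx n) :
    opQ a * opP b = opP b * opQ a + (if a = b then 1 else 0) := by
  rcases a with i | i <;> rcases b with j | j <;>
    simp [opQ, opP, dX_comm (Sum.inr i), mulX_comm (Sum.inl i), dX_mulX, eq_comm]

theorem opE_lie {n : ℕ} (a b c d : Idx n) :
    opE a b * opE c d - opE c d * opE a b =
      (if b = c then opE a d else 0) - (if d = a then opE c b else 0) := by
  simp only [opE_eq]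
  have h1 : opP a * opQ b * (opP c * opQ d) =
      opP a * opP c * (opQ b * opQ d) + (if b = c then opP a * opQ d else 0) := by
    calc opP a * opQ b * (opP c * opQ d) = opP a * (opQ b * opP c) * opQ d := by noncomm_ring
      _ = _ := by rw [opQ_opP]; split_ifs <;> noncomm_ring
  have h2 : opP c * opQ d * (opP a * opQ b) =
      opP c * opP a * (opQ d * opQ b) + (if d = a then opP c * opQ b else 0) := by
    calc opP c * opQ d * (opP a * opQ b) = opP c * (opQ d * opP a) * opQ b := by noncomm_ring
      _ = _ := by rw [opQ_opP]; split_ifs <;> noncomm_ring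
  rw [h1, h2, opP_comm c a, opQ_comm d b]
  abel

/-- The linear extension of `E_{a,b} ↦ opE a b`. -/
def repLin (n : ℕ) : Gl n →ₗ[ℂ] Module.End ℂ (Poly n) where
  toFun M := ∑ a, ∑ b, M a b • opE a b
  map_add' M N := by
    simp only [Matrix.add_apply, add_smul, Finset.sum_add_distrib]
  map_smul' c M := by
    simp only [Matrix.smul_apply, smul_eq_mul, mul_smul, Finset.smul_sum, RingHom.id_apply]

theorem repLin_single {n : ℕ} (a b : Idx n) (c : ℂ) :
    repLin n (Matrix.single a b c) = c • opE a b := by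
  change ∑ a', ∑ b', Matrix.single a b c a' b' • opE a' b' = _
  rw [Finset.sum_eq_single a, Finset.sum_eq_single b]
  · simp
  · intro b' _ h; simp [Ne.symm h]
  · simp
  · intro a' _ h; simp [Ne.symm h]
  · simp

theorem repLin_lie {n : ℕ} (M N : Gl n) : repLin n ⁅M, N⁆ = ⁅repLin n M, repLin n N⁆ := by
  induction M using Matrix.induction_on' with
  | h_zero => simp
  | h_add p q hp hq => rw [add_lie, map_add, hp, hq, map_add, add_lie]
  | h_std_basis a b x =>
    induction N using Matrix.induction_on' with
    | h_zero => simp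
    | h_add p q hp hq => rw [lie_add, map_add, hp, hq, map_add, lie_add]
    | h_std_basis c d y =>
      have key := opE_lie a b c d
      rw [repLin_single, repLin_single, smul_lie, lie_smul, Ring.lie_def (opE a b), key,
        Ring.lie_def, map_sub]
      by_cases h1 : b = c <;> by_cases h2 : d = a
      · subst h1 h2
        simp only [Matrix.single_mul_single_same, repLin_single, if_true, smul_sub, smul_smul,
          mul_comm y x]
      · subst h1
        rw [Matrix.single_mul_single_same, Matrix.single_mul_single_of_ne _ _ _ _ h2]
        simp [repLin_single, h2, smul_smul]
      · subst h2
        rw [Matrix.single_mul_single_same, Matrix.single_mul_single_of_ne _ _ _ _ h1]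
        simp [repLin_single, h1, smul_smul, mul_comm y x]
      · rw [Matrix.single_mul_single_of_ne _ _ _ _ h1, Matrix.single_mul_single_of_ne _ _ _ _ h2]
        simp [h1, h2]

/-- The noncanonical representation of `gl(2n, ℂ)` on `𝓐`. -/
def rep (n : ℕ) : Gl n →ₗ⁅ℂ⁆ Module.End ℂ (Poly n) :=
  { repLin n with map_lie' := fun {M N} => repLin_lie M N }

/-- The resulting `gl(2n, ℂ)`-module structure on `𝓐`; its restriction to `so(2n, ℂ)` is the one
that Mathlib attaches to a Lie subalgebra. -/
instance instLieRingModuleGlPoly (n : ℕ) : LieRingModule (Gl n) (Poly n) :=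
  LieRingModule.compLieHom (Poly n) (rep n)

instance instLieModuleGlPoly (n : ℕ) : LieModule ℂ (Gl n) (Poly n) :=
  LieModule.compLieHom (Poly n) (rep n)

theorem lie_E {n : ℕ} (a b : Idx n) (f : Poly n) : ⁅E a b, f⁆ = opE a b f := by
  change repLin n (E a b) f = _
  rw [E, repLin_single, one_smul]

/-! ### The graded pieces and the operators `Δ`, `η` -/

/-- `𝓐_⟨k⟩`, the span of the monomials `x^α` with `∑ α_{n+i} - ∑ α_i = k`. -/
def gradedPiece (n : ℕ) (k : ℤ) : Submodule ℂ (Poly n) :=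
  Submodule.span ℂ {f | ∃ α : Idx n →₀ ℕ,
    (∑ i, (α (.inr i) : ℤ)) - ∑ i, (α (.inl i) : ℤ) = k ∧ f = MvPolynomial.monomial α 1}

/-- `Δ = -∑ x_i ∂_{x_{n+i}}`. -/
def Δ (n : ℕ) : Module.End ℂ (Poly n) := -∑ i : Fin n, mulX (.inl i) * dX (.inr i)

/-- `η = ∑ x_{n+i} ∂_{x_i}`. -/
def η (n : ℕ) : Module.End ℂ (Poly n) := ∑ i : Fin n, mulX (.inr i) * dX (.inl i)

/-- `𝓗_⟨k⟩ = {f ∈ 𝓐_⟨k⟩ | Δ f = 0}`. -/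
def kerΔ (n : ℕ) (k : ℤ) : Submodule ℂ (Poly n) := gradedPiece n k ⊓ LinearMap.ker (Δ n)

/-- `𝓗'_⟨k⟩ = {f ∈ 𝓐_⟨k⟩ | η f = 0}`. -/
def kerη (n : ℕ) (k : ℤ) : Submodule ℂ (Poly n) := gradedPiece n k ⊓ LinearMap.ker (η n)

/-! ### Cartan subalgebra, positive roots, fundamental weights -/

/-- `E_{i,i} - E_{n+i,n+i}`. -/
def cartanElt {n : ℕ} (i : Fin n) : Gl n := E (.inl i) (.inl i) - E (.inr i) (.inr i)

/-- The Cartan subalgebra `H = ∑ ℂ (E_{i,i} - E_{n+i,n+i})`. -/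
def cartan (n : ℕ) : Submodule ℂ (Gl n) := Submodule.span ℂ (Set.range (cartanElt (n := n)))

/-- The span `𝓖₊` of the positive root vectors
`E_{i,j} - E_{n+j,n+i}` and `E_{i,n+j} - E_{j,n+i}`, `i < j`. -/
def posPart (n : ℕ) : Submodule ℂ (Gl n) :=
  Submodule.span ℂ {M | ∃ i j : Fin n, i < j ∧
    (M = E (.inl i) (.inl j) - E (.inr j) (.inr i) ∨
     M = E (.inl i) (.inr j) - E (.inl j) (.inr i))}

/-- The functional `ε_i` on `H`, reading off the `(i,i)` entry. -/
def eps {n : ℕ} (i : Fin n) : Module.Dual ℂ (cartan n) :=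
  (Matrix.entryLinearMap ℂ ℂ (Sum.inl i) (Sum.inl i)).comp (cartan n).subtype

/-- The coroots `h_i` (`0`-based: `Fin n` index `i` stands for `i + 1`):
`h_i = (E_{i,i} - E_{n+i,n+i}) - (E_{i+1,i+1} - E_{n+i+1,n+i+1})` for `i < n`, and
`h_n = (E_{n-1,n-1} - E_{2n-1,2n-1}) + (E_{n,n} - E_{2n,2n})`. Meaningful for `2 ≤ n`. -/
def coroot {n : ℕ} (i : Fin n) : Gl n :=
  if h : i.1 + 1 < n then cartanElt i - cartanElt ⟨i.1 + 1, h⟩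
  else cartanElt ⟨n - 2, by have := i.2; omega⟩ + cartanElt i

theorem coroot_mem {n : ℕ} (i : Fin n) : coroot i ∈ cartan n := by
  have h (j : Fin n) : cartanElt j ∈ cartan n := Submodule.subset_span ⟨j, rfl⟩
  unfold coroot
  split_ifs
  · exact sub_mem (h _) (h _)
  · exact add_mem (h _) (h _)

/-- The fundamental weights `λ_i` of `so(2n, ℂ)` (`0`-based: `Fin n` index `i` is `λ_{i+1}`):
`λ_i = ε_1 + ⋯ + ε_i` for `i ≤ n - 2`, `λ_{n-1} = (ε_1 + ⋯ + ε_{n-1} - ε_n) / 2` and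
`λ_n = (ε_1 + ⋯ + ε_n) / 2`. By `fundWeight_coroot` these are the functionals dual to the
coroots. -/
def fundWeight {n : ℕ} (i : Fin n) : Module.Dual ℂ (cartan n) :=
  if i.1 + 2 < n then ∑ j ∈ Finset.Iic i, eps j
  else if h : i.1 + 2 = n then
    (2⁻¹ : ℂ) • (∑ j, eps j) - eps ⟨i.1 + 1, by omega⟩
  else (2⁻¹ : ℂ) • ∑ j, eps j

theorem eps_cartanElt {n : ℕ} (i j : Fin n) (h : cartanElt j ∈ cartan n) :
    eps i ⟨cartanElt j, h⟩ = if i = j then 1 else 0 := by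
  simp [eps, cartanElt, E, Matrix.single_apply, eq_comm]

theorem fundWeight_coroot {n : ℕ} (hn : 2 ≤ n) (i j : Fin n) :
    fundWeight i ⟨coroot j, coroot_mem j⟩ = if i = j then 1 else 0 := by
  have hm (j : Fin n) : cartanElt j ∈ cartan n := Submodule.subset_span ⟨j, rfl⟩
  have hc : (⟨coroot j, coroot_mem j⟩ : cartan n) =
      if h : j.1 + 1 < n then ⟨cartanElt j, hm j⟩ - ⟨cartanElt ⟨j.1 + 1, h⟩, hm _⟩
      else ⟨cartanElt ⟨n - 2, by have := j.2; omega⟩, hm _⟩ + ⟨cartanElt j, hm j⟩ := by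
    apply Subtype.ext
    by_cases h : j.1 + 1 < n <;> simp [coroot, h]
  have hi := i.2
  have hj := j.2
  rw [hc]
  unfold fundWeight
  split_ifs <;>
    simp only [map_sub, map_add, LinearMap.sum_apply, eps_cartanElt, LinearMap.sub_apply,
      LinearMap.smul_apply, Finset.sum_ite_eq', Finset.mem_Iic, Finset.mem_univ, if_true,
      smul_eq_mul] <;>
    simp only [Fin.le_def, Fin.ext_iff] at * <;>
    (try split_ifs) <;> first | omega | norm_num

/-- `v` generates the `so(2n, ℂ)`-submodule `N` of `𝓐` and is a highest weight vector of weight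
`μ`; that is, `N` is a highest weight module with highest weight `μ` and highest weight
vector `v`. -/
structure IsHighestWeight {n : ℕ} (N : LieSubmodule ℂ (so n) (Poly n))
    (μ : Module.Dual ℂ (cartan n)) (v : Poly n) : Prop where
  ne_zero : v ≠ 0
  weight : ∀ h : cartan n, ⁅(h : Gl n), v⁆ = μ h • v
  annihilated : ∀ X ∈ posPart n, ⁅X, v⁆ = 0
  generates : LieSubmodule.lieSpan ℂ (so n) {v} = N

/-! ### The bases -/

/-- Pairs `i < j` of indices. -/
abbrev Pair (n : ℕ) : Type := {p : Fin n × Fin n // p.1 < p.2}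

/-- Exponent vectors `((k_t)_t, (k_{i,j})_{i<j})` with `∑ k_t = d`, with `k_{i,j} k_t = 0` for
`i < j < t`, and with `k_{i,j} k_{i₁,j₁} = 0` for `i < i₁` and `j > j₁`. -/
def NoncrossingExp (n : ℕ) (d : ℤ) : Type :=
  {e : (Fin n → ℕ) × (Pair n → ℕ) //
    (∑ t, (e.1 t : ℤ)) = d ∧
    (∀ (p : Pair n) (t : Fin n), p.1.2 < t → e.2 p * e.1 t = 0) ∧
    (∀ p q : Pair n, p.1.1 < q.1.1 → q.1.2 < p.1.2 → e.2 p * e.2 q = 0)}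

/-- The product `∏_{i<j} (x_i x_{n+j} - x_j x_{n+i})^{k_{i,j}}`. -/
def minorProd {n : ℕ} (κ : Pair n → ℕ) : Poly n :=
  ∏ p : Pair n, (MvPolynomial.X (.inl p.1.1) * MvPolynomial.X (.inr p.1.2)
    - MvPolynomial.X (.inl p.1.2) * MvPolynomial.X (.inr p.1.1)) ^ κ p

/-- `∏ x_{n+t}^{k_t} ∏_{i<j} (x_i x_{n+j} - x_j x_{n+i})^{k_{i,j}}`. -/
def basisη {n : ℕ} {d : ℤ} (e : NoncrossingExp n d) : Poly n :=
  (∏ t, MvPolynomial.X (.inr t) ^ e.1.1 t) * minorProd e.1.2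

/-- `∏ x_t^{k_t} ∏_{i<j} (x_i x_{n+j} - x_j x_{n+i})^{k_{i,j}}`. -/
def basisΔ {n : ℕ} {d : ℤ} (e : NoncrossingExp n d) : Poly n :=
  (∏ t, MvPolynomial.X (.inl t) ^ e.1.1 t) * minorProd e.1.2

end

end SoPoly

namespace SoPoly

noncomputable section

variable {n : ℕ}

/-! The operators `η`, `-Δ` and `eulerY - eulerX` form an `sl(2)`-triple commuting with `so(2n, ℂ)`,
and `𝓐_⟨k⟩` is the eigenspace of the third for the eigenvalue `k`. Since `η` lowers the degree in
`x_1, …, x_n`, it is locally nilpotent, and for `k ≥ 0` an `sl(2)` argument splits `𝓐_⟨k⟩` into the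
kernel of `η` and the image of `Δ` (`disjoint_kerη_mapΔ`, `kerη_sup_mapΔ`).

Irreducibility rests on the Capelli type identity `sum_opM_opD_of_η_eq_zero`: on the kernel of `η`,
the sum of the `opM i j * opD i j` acts on a component of degree `m` in the `x_i` by `2m(m + k +
1)`, which is nonzero for `m > 0` and `k ≥ 0`. Read one way, it recovers any element of `𝓗'_⟨k⟩`
from polynomials in `x_{n+1}, …, x_{2n}` by multiplication by minors (`kerη_le`). Read the other
way, an element killed by all `opD` involves no `x_i`, so every nonzero submodule contains a
polynomial in the `x_{n+t}` alone; there the operators `opL` lead to `x_{2n}^k` and back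
(`X_pow_mem_of_stable`, `kerη_le_of_stable`).

The basis is a standard monomial basis. Three-term Plücker relations straighten arbitrary products
(`yMinorProd_mem`), and the leading monomial `x_i x_{n+j}` of each minor gives independence, because
an admissible exponent vector can be recovered from its leading monomial (`leadExp_injective`).

The case `k < 0` follows by the exchange `x_i ↔ x_{n+i}`, which carries `η` to `-Δ`. -/

/-- The action of `-(E_{i,j} - E_{n+j,n+i})`, up to a constant. -/
def opL (i j : Fin n) : Module.End ℂ (Poly n) :=
  mulX (.inl j) * dX (.inl i) + mulX (.inr j) * dX (.inr i)

/-- The action of `E_{i,n+j} - E_{j,n+i}`. -/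
def opD (i j : Fin n) : Module.End ℂ (Poly n) :=
  dX (.inl i) * dX (.inr j) - dX (.inl j) * dX (.inr i)

/-- The `2 × 2` minor `x_i x_{n+j} - x_j x_{n+i}`. -/
def minor (i j : Fin n) : Poly n :=
  MvPolynomial.X (.inl i) * MvPolynomial.X (.inr j)
    - MvPolynomial.X (.inl j) * MvPolynomial.X (.inr i)

/-- Multiplication by a minor; the action of `E_{n+i,j} - E_{n+j,i}` up to sign. -/
def opM (i j : Fin n) : Module.End ℂ (Poly n) :=
  mulX (.inl i) * mulX (.inr j) - mulX (.inl j) * mulX (.inr i)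

/-- The Euler operator in the variables `x_1, …, x_n`. -/
def eulerX (n : ℕ) : Module.End ℂ (Poly n) := ∑ i : Fin n, mulX (.inl i) * dX (.inl i)

/-- The Euler operator in the variables `x_{n+1}, …, x_{2n}`. -/
def eulerY (n : ℕ) : Module.End ℂ (Poly n) := ∑ i : Fin n, mulX (.inr i) * dX (.inr i)

theorem opM_apply (i j : Fin n) (f : Poly n) : opM i j f = minor i j * f := by
  simp only [opM, minor, LinearMap.sub_apply, Module.End.mul_apply, mulX_apply]
  ring

/-! ### Commutation of `η` with the action, and the Capelli identity -/

theorem η_mulX_inl (j : Fin n) :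
    η n * mulX (.inl j) = mulX (.inl j) * η n + mulX (.inr j) := by
  simp only [η, Finset.sum_mul, mul_assoc, dX_mulX, Finset.mul_sum, mul_add,
    Finset.sum_add_distrib, Sum.inl.injEq]
  congr 1
  · refine Finset.sum_congr rfl fun i _ => ?_
    rw [← mul_assoc, mulX_comm, mul_assoc]
  · simp [Finset.sum_ite_eq']

theorem η_mulX_inr (j : Fin n) : η n * mulX (.inr j) = mulX (.inr j) * η n := by
  simp only [η, Finset.sum_mul, Finset.mul_sum]
  refine Finset.sum_congr rfl fun i _ => ?_
  rw [mul_assoc, dX_mulX, ← mul_assoc, ← mulX_comm]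
  simp [mul_assoc]

theorem η_dX_inl (j : Fin n) : η n * dX (.inl j) = dX (.inl j) * η n := by
  simp only [η, Finset.sum_mul, Finset.mul_sum]
  refine Finset.sum_congr rfl fun i _ => ?_
  rw [mul_assoc, dX_comm, ← mul_assoc, ← mul_assoc, dX_mulX]
  simp

theorem dX_inr_η (j : Fin n) :
    dX (.inr j) * η n = η n * dX (.inr j) + dX (.inl j) := by
  simp only [η, Finset.sum_mul, Finset.mul_sum]
  have h (i : Fin n) : dX (.inr j) * (mulX (.inr i) * dX (.inl i)) =
      mulX (.inr i) * dX (.inl i) * dX (.inr j) + if j = i then dX (n := n) (.inl i) else 0 := by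
    rw [← mul_assoc, dX_mulX, add_mul, mul_assoc, dX_comm, mul_assoc]
    simp [ite_mul]
  simp [h, Finset.sum_add_distrib]

theorem η_dX_inr (j : Fin n) :
    η n * dX (.inr j) = dX (.inr j) * η n - dX (.inl j) := by
  rw [dX_inr_η, add_sub_cancel_right]

theorem η_opL (i j : Fin n) : η n * opL i j = opL i j * η n := by
  rw [opL, mul_add, ← mul_assoc, ← mul_assoc, η_mulX_inl, η_mulX_inr, add_mul, mul_assoc, mul_assoc,
    η_dX_inl, η_dX_inr]
  noncomm_ring

theorem η_opD (i j : Fin n) : η n * opD i j = opD i j * η n := by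
  rw [opD, mul_sub, ← mul_assoc, ← mul_assoc, η_dX_inl, η_dX_inl, mul_assoc, mul_assoc,
    η_dX_inr, η_dX_inr, mul_sub, mul_sub, dX_comm (.inl j) (.inl i)]
  noncomm_ring

theorem η_opM (i j : Fin n) : η n * opM i j = opM i j * η n := by
  rw [opM, mul_sub, ← mul_assoc, ← mul_assoc, η_mulX_inl, η_mulX_inl, add_mul, add_mul, mul_assoc,
    mul_assoc, η_mulX_inr, η_mulX_inr, mulX_comm (.inr j) (.inr i)]
  noncomm_ring

theorem opD_swap (i j : Fin n) : opD j i = -opD i j := by simp [opD]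

/-- One half of the Capelli computation: contracting a single index assembles `η` and `eulerY`. The
term with `η` is written with `η` on the right so that it vanishes on the kernel of `η`. -/
theorem sum_mulX_opD (j : Fin n) :
    ∑ i, mulX (.inr i) * opD i j =
      dX (.inr j) * η n - dX (.inl j) - eulerY n * dX (.inl j) := by
  rw [dX_inr_η, add_sub_cancel_right, η, eulerY, Finset.sum_mul, Finset.sum_mul,
    ← Finset.sum_sub_distrib]
  refine Finset.sum_congr rfl fun i _ => ?_
  rw [opD, mul_sub, mul_assoc, mul_assoc, dX_comm (.inl j)]

theorem mulX_inl_eulerY (j : Fin n) :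
    mulX (.inl j) * eulerY n = eulerY n * mulX (.inl j) := by
  simp only [eulerY, Finset.sum_mul, Finset.mul_sum]
  refine Finset.sum_congr rfl fun i _ => ?_
  rw [mul_assoc, dX_mulX, ← mul_assoc, mulX_comm]
  simp [mul_assoc]

/-- A Capelli type identity. -/
theorem sum_opM_opD_of_η_eq_zero {f : Poly n} (hf : η n f = 0) :
    ∑ i, ∑ j, opM i j (opD i j f) = (2 : ℂ) • (eulerX n f + eulerY n (eulerX n f)) := by
  have h1 (j : Fin n) : ∑ i, mulX (.inr i) (opD i j f) = -dX (.inl j) f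
      - eulerY n (dX (.inl j) f) := by
    have := LinearMap.congr_fun (sum_mulX_opD j) f
    simpa [LinearMap.sum_apply, hf] using this
  have h2' (j : Fin n) : ∑ i, mulX (.inl j) (mulX (.inr i) (opD i j f)) =
      -(mulX (.inl j) (dX (.inl j) f) + eulerY n (mulX (.inl j) (dX (.inl j) f))) := by
    have hc : mulX (.inl j) (eulerY n (dX (.inl j) f)) =
      eulerY n (mulX (.inl j) (dX (.inl j) f)) := LinearMap.congr_fun (mulX_inl_eulerY j) _
    rw [← map_sum, h1, map_sub, map_neg, hc, neg_add, sub_eq_add_neg]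
  have hX : eulerX n f = ∑ j, mulX (.inl j) (dX (.inl j) f) := by
    rw [eulerX, LinearMap.sum_apply]; rfl
  have h2 : ∑ i, ∑ j, mulX (.inl j) (mulX (.inr i) (opD i j f)) =
      -(eulerX n f + eulerY n (eulerX n f)) := by
    rw [Finset.sum_comm, Finset.sum_congr rfl fun j _ => h2' j, Finset.sum_neg_distrib,
      Finset.sum_add_distrib, ← map_sum, ← hX]
  -- Antisymmetry of `opD` makes the two halves of the sum opposite, whence the factor 2.
  have h3 : ∑ i, ∑ j, mulX (.inl i) (mulX (.inr j) (opD i j f)) =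
      -∑ i, ∑ j, mulX (.inl j) (mulX (.inr i) (opD i j f)) := by
    rw [Finset.sum_comm, ← Finset.sum_neg_distrib]
    refine Finset.sum_congr rfl fun i _ => ?_
    rw [← Finset.sum_neg_distrib]
    refine Finset.sum_congr rfl fun j _ => ?_
    rw [opD_swap i j, LinearMap.neg_apply, map_neg, map_neg]
  have h4 : ∑ i, ∑ j, opM i j (opD i j f) =
      ∑ i, ∑ j, mulX (.inl i) (mulX (.inr j) (opD i j f)) -
      ∑ i, ∑ j, mulX (.inl j) (mulX (.inr i) (opD i j f)) := by
    rw [← Finset.sum_sub_distrib]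
    refine Finset.sum_congr rfl fun i _ => ?_
    rw [← Finset.sum_sub_distrib]
    rfl
  rw [h4, h3, h2, two_smul]
  abel

/-! ### Gradings -/

theorem coeff_of_coeff_mulX_ne_zero {a : Idx n} {f : Poly n} {α : Idx n →₀ ℕ}
    (h : (mulX a f).coeff α ≠ 0) : ∃ β, α = β + Finsupp.single a 1 ∧ f.coeff β ≠ 0 := by
  rw [mulX_apply, MvPolynomial.coeff_X_mul'] at h
  split_ifs at h with ha
  · refine ⟨α - Finsupp.single a 1, ?_, h⟩
    rw [tsub_add_cancel_of_le]
    simpa [Finsupp.single_le_iff, Nat.one_le_iff_ne_zero] using ha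
  · exact absurd rfl h

theorem coeff_of_coeff_dX_ne_zero {a : Idx n} {f : Poly n} {α : Idx n →₀ ℕ}
    (h : (dX a f).coeff α ≠ 0) : f.coeff (α + Finsupp.single a 1) ≠ 0 := by
  rw [dX_apply, MvPolynomial.coeff_pderiv] at h
  exact fun h' => h (by simp [h'])

theorem coeff_mulX_dX (a : Idx n) (f : Poly n) (α : Idx n →₀ ℕ) :
    (mulX a (dX a f)).coeff α = α a * f.coeff α := by
  rw [mulX_apply, MvPolynomial.coeff_X_mul', dX_apply, MvPolynomial.coeff_pderiv]
  split_ifs with ha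
  · have h1 : 1 ≤ α a := by simpa [Nat.one_le_iff_ne_zero] using ha
    rw [tsub_add_cancel_of_le (by simpa [Finsupp.single_le_iff] using h1)]
    simp [Nat.cast_sub h1, mul_comm]
  · have : α a = 0 := by simpa using ha
    simp [this]

/-- The degree in `x_1, …, x_n`. -/
def xdeg (α : Idx n →₀ ℕ) : ℕ := ∑ i, α (.inl i)

/-- The degree in `x_{n+1}, …, x_{2n}`. -/
def ydeg (α : Idx n →₀ ℕ) : ℕ := ∑ i, α (.inr i)

theorem coeff_eulerX (f : Poly n) (α : Idx n →₀ ℕ) :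
    (eulerX n f).coeff α = xdeg α * f.coeff α := by
  simp only [eulerX, LinearMap.sum_apply, Module.End.mul_apply, MvPolynomial.coeff_sum,
    coeff_mulX_dX, xdeg, Nat.cast_sum, Finset.sum_mul]

theorem coeff_eulerY (f : Poly n) (α : Idx n →₀ ℕ) :
    (eulerY n f).coeff α = ydeg α * f.coeff α := by
  simp only [eulerY, LinearMap.sum_apply, Module.End.mul_apply, MvPolynomial.coeff_sum,
    coeff_mulX_dX, ydeg, Nat.cast_sum, Finset.sum_mul]

/-- Polynomials all of whose monomials have `w`-weight less than `m`. -/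
def weightLT (w : Idx n → ℕ) (m : ℕ) : Submodule ℂ (Poly n) where
  carrier := {f | ∀ α, f.coeff α ≠ 0 → Finsupp.weight w α < m}
  zero_mem' := by simp
  add_mem' {f g} hf hg α h := by
    by_cases h1 : f.coeff α = 0
    · exact hg α (by simpa [h1] using h)
    · exact hf α h1
  smul_mem' c f hf α h := hf α (by
    intro h'
    simp [h'] at h)

theorem mem_weightLT {w : Idx n → ℕ} {m : ℕ} {f : Poly n} :
    f ∈ weightLT w m ↔ ∀ α, f.coeff α ≠ 0 → Finsupp.weight w α < m := Iff.rfl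

theorem exists_mem_weightLT (w : Idx n → ℕ) (f : Poly n) : ∃ m, f ∈ weightLT w m := by
  refine ⟨f.support.sup (Finsupp.weight w) + 1, fun α h => Nat.lt_succ_of_le ?_⟩
  exact Finset.le_sup (f := Finsupp.weight w) (MvPolynomial.mem_support_iff.2 h)

/-- The bound in `weightLT` is strict so that `m = 0` leaves only the zero polynomial; this is the
base case of the inductions on degree below. -/
theorem eq_zero_of_mem_weightLT_zero {w : Idx n → ℕ} {f : Poly n} (hf : f ∈ weightLT w 0) :
    f = 0 := by
  ext α
  by_contra h
  exact absurd (hf α (by simpa using h)) (Nat.not_lt_zero _)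

theorem mulX_mem_weightLT {w : Idx n → ℕ} {m : ℕ} {f : Poly n} (a : Idx n)
    (hf : f ∈ weightLT w m) : mulX a f ∈ weightLT w (m + w a) := by
  intro α h
  obtain ⟨β, rfl, hβ⟩ := coeff_of_coeff_mulX_ne_zero h
  have := hf β hβ
  simpa [Finsupp.weight_single] using this

theorem dX_mem_weightLT {w : Idx n → ℕ} {m : ℕ} {f : Poly n} (a : Idx n)
    (hf : f ∈ weightLT w (m + w a)) : dX a f ∈ weightLT w m := by
  intro α h
  have := hf _ (coeff_of_coeff_dX_ne_zero h)
  simpa [Finsupp.weight_single] using this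

/-- The weight giving the degree in `x_1, …, x_n`. -/
def xweight : Idx n → ℕ := Sum.elim 1 0

theorem weight_xweight (α : Idx n →₀ ℕ) : Finsupp.weight xweight α = xdeg α := by
  simp [Finsupp.weight_eq_sum, xweight, xdeg]

theorem dX_inl_mem {m : ℕ} {f : Poly n} (i : Fin n) (hf : f ∈ weightLT xweight (m + 1)) :
    dX (.inl i) f ∈ weightLT xweight m := dX_mem_weightLT _ hf

theorem dX_inr_mem {m : ℕ} {f : Poly n} (i : Fin n) (hf : f ∈ weightLT xweight m) :
    dX (.inr i) f ∈ weightLT xweight m := dX_mem_weightLT _ hf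

theorem η_mem_weightLT {m : ℕ} {f : Poly n} (hf : f ∈ weightLT xweight (m + 1)) :
    η n f ∈ weightLT xweight m := by
  rw [η, LinearMap.sum_apply]
  exact sum_mem fun i _ => mulX_mem_weightLT (.inr i) (dX_inl_mem i hf)

theorem opD_mem_weightLT {m : ℕ} {f : Poly n} (i j : Fin n)
    (hf : f ∈ weightLT xweight (m + 1)) : opD i j f ∈ weightLT xweight m :=
  sub_mem (dX_inl_mem i (dX_inr_mem j hf)) (dX_inl_mem j (dX_inr_mem i hf))

/-- The weight defining the `ℤ`-grading by the `𝓐_⟨k⟩`. -/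
def gradeWeight : Idx n → ℤ := Sum.elim (-1) 1

theorem weight_gradeWeight (α : Idx n →₀ ℕ) :
    Finsupp.weight gradeWeight α = (ydeg α : ℤ) - xdeg α := by
  simp [Finsupp.weight_eq_sum, gradeWeight, xdeg, ydeg]
  ring

/-- Weighted homogeneity with weights `-1` and `1` supplies multiplicativity of the grading and a
criterion on coefficients. -/
theorem gradedPiece_eq (k : ℤ) :
    gradedPiece n k = MvPolynomial.weightedHomogeneousSubmodule ℂ gradeWeight k := by
  apply le_antisymm
  · refine Submodule.span_le.2 ?_
    rintro _ ⟨α, hα, rfl⟩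
    refine MvPolynomial.isWeightedHomogeneous_monomial _ _ _ ?_
    rw [weight_gradeWeight, ← hα]
    simp [xdeg, ydeg]
  · intro f hf
    rw [f.as_sum]
    refine sum_mem fun α hα => ?_
    rw [← mul_one (f.coeff α), ← smul_eq_mul, ← MvPolynomial.smul_monomial]
    refine Submodule.smul_mem _ _ (Submodule.subset_span ⟨α, ?_, rfl⟩)
    have := hf (MvPolynomial.mem_support_iff.1 hα)
    rw [weight_gradeWeight] at this
    simpa [xdeg, ydeg] using this

theorem mem_gradedPiece {k : ℤ} {f : Poly n} :
    f ∈ gradedPiece n k ↔ MvPolynomial.IsWeightedHomogeneous gradeWeight f k := by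
  rw [gradedPiece_eq]; rfl

theorem coeff_grade {k : ℤ} {f : Poly n} (hf : f ∈ gradedPiece n k) {α : Idx n →₀ ℕ}
    (h : f.coeff α ≠ 0) : (ydeg α : ℤ) - xdeg α = k := by
  rw [← weight_gradeWeight]; exact mem_gradedPiece.1 hf h

theorem mul_mem_gradedPiece {k l m : ℤ} {f g : Poly n} (hf : f ∈ gradedPiece n k)
    (hg : g ∈ gradedPiece n l) (h : k + l = m) : f * g ∈ gradedPiece n m := by
  rw [mem_gradedPiece] at *
  exact h ▸ hf.mul hg

theorem X_mem_gradedPiece (a : Idx n) : MvPolynomial.X a ∈ gradedPiece n (gradeWeight a) :=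
  mem_gradedPiece.2 (MvPolynomial.isWeightedHomogeneous_X _ _ _)

theorem mulX_mem_gradedPiece {k l : ℤ} {f : Poly n} (a : Idx n) (hf : f ∈ gradedPiece n k)
    (h : k + gradeWeight a = l) : mulX a f ∈ gradedPiece n l :=
  mul_mem_gradedPiece (X_mem_gradedPiece a) hf (by rw [← h, add_comm])

theorem dX_mem_gradedPiece {k l : ℤ} {f : Poly n} (a : Idx n) (hf : f ∈ gradedPiece n k)
    (h : l + gradeWeight a = k) : dX a f ∈ gradedPiece n l := by
  rw [mem_gradedPiece] at *
  intro α hα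
  have := hf (coeff_of_coeff_dX_ne_zero hα)
  rw [map_add, Finsupp.weight_single, one_smul] at this
  omega

theorem mulX_dX_mem_gradedPiece {k l : ℤ} {f : Poly n} (a b : Idx n) (hf : f ∈ gradedPiece n k)
    (h : k + gradeWeight a = l + gradeWeight b) : (mulX a * dX b) f ∈ gradedPiece n l :=
  mulX_mem_gradedPiece a (dX_mem_gradedPiece (l := k - gradeWeight b) b hf (by omega)) (by omega)

theorem η_mem_gradedPiece {k l : ℤ} {f : Poly n} (hf : f ∈ gradedPiece n k) (h : k + 2 = l) :
    η n f ∈ gradedPiece n l := by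
  rw [η, LinearMap.sum_apply]
  exact (gradedPiece n l).sum_mem fun i _ =>
    mulX_dX_mem_gradedPiece (.inr i) (.inl i) hf (by simp [gradeWeight]; omega)

theorem Δ_mem_gradedPiece {k l : ℤ} {f : Poly n} (hf : f ∈ gradedPiece n k) (h : l + 2 = k) :
    Δ n f ∈ gradedPiece n l := by
  rw [Δ, LinearMap.neg_apply, LinearMap.sum_apply]
  exact (gradedPiece n l).neg_mem ((gradedPiece n l).sum_mem fun i _ =>
    mulX_dX_mem_gradedPiece (.inl i) (.inr i) hf (by simp [gradeWeight]; omega))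

theorem opL_mem_gradedPiece {k : ℤ} {f : Poly n} (i j : Fin n) (hf : f ∈ gradedPiece n k) :
    opL i j f ∈ gradedPiece n k :=
  (gradedPiece n k).add_mem (mulX_dX_mem_gradedPiece (.inl j) (.inl i) hf rfl)
    (mulX_dX_mem_gradedPiece (.inr j) (.inr i) hf rfl)

theorem opD_mem_gradedPiece {k : ℤ} {f : Poly n} (i j : Fin n) (hf : f ∈ gradedPiece n k) :
    opD i j f ∈ gradedPiece n k := by
  have h (i j : Fin n) : dX (.inl i) (dX (.inr j) f) ∈ gradedPiece n k :=
    dX_mem_gradedPiece (k := k - 1) (.inl i)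
      (dX_mem_gradedPiece (.inr j) hf (by simp [gradeWeight])) (by simp [gradeWeight]; omega)
  exact (gradedPiece n k).sub_mem (h i j) (h j i)

theorem opM_mem_gradedPiece {k : ℤ} {f : Poly n} (i j : Fin n) (hf : f ∈ gradedPiece n k) :
    opM i j f ∈ gradedPiece n k := by
  have h (i j : Fin n) : mulX (.inl i) (mulX (.inr j) f) ∈ gradedPiece n k :=
    mulX_mem_gradedPiece (k := k + 1) (.inl i)
      (mulX_mem_gradedPiece (.inr j) hf (by simp [gradeWeight])) (by simp [gradeWeight])
  exact (gradedPiece n k).sub_mem (h i j) (h j i)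

/-! ### Exchanging the two groups of variables -/

/-- The exchange `x_i ↔ x_{n+i}`. -/
def swapXY (n : ℕ) : Poly n ≃ₐ[ℂ] Poly n := MvPolynomial.renameEquiv ℂ (Equiv.sumComm _ _)

theorem swapXY_X (a : Idx n) : swapXY n (MvPolynomial.X a) = MvPolynomial.X a.swap := by
  simp [swapXY]

theorem swapXY_swapXY (f : Poly n) : swapXY n (swapXY n f) = f := by
  simp [swapXY, MvPolynomial.rename_rename]

theorem swapXY_mulX (a : Idx n) (f : Poly n) :
    swapXY n (mulX a f) = mulX a.swap (swapXY n f) := by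
  rw [mulX_apply, mulX_apply, map_mul, swapXY_X]

theorem swapXY_dX (a : Idx n) (f : Poly n) :
    swapXY n (dX a f) = dX a.swap (swapXY n f) := by
  have := MvPolynomial.pderiv_rename (R := ℂ) (Equiv.sumComm (Fin n) (Fin n)).injective a f
  exact this.symm

theorem swapXY_η (f : Poly n) : swapXY n (η n f) = -Δ n (swapXY n f) := by
  simp only [η, Δ, LinearMap.neg_apply, LinearMap.sum_apply, Module.End.mul_apply, map_sum,
    swapXY_mulX, swapXY_dX, neg_neg, Sum.swap_inl, Sum.swap_inr]

theorem swapXY_Δ (f : Poly n) : swapXY n (Δ n f) = -η n (swapXY n f) := by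
  rw [← swapXY_swapXY (η n (swapXY n f)), swapXY_η, swapXY_swapXY, map_neg, neg_neg]

theorem swapXY_opL (i j : Fin n) (f : Poly n) :
    swapXY n (opL i j f) = opL i j (swapXY n f) := by
  simp only [opL, LinearMap.add_apply, Module.End.mul_apply, map_add, swapXY_mulX, swapXY_dX,
    Sum.swap_inl, Sum.swap_inr]
  exact add_comm _ _

theorem swapXY_opD (i j : Fin n) (f : Poly n) :
    swapXY n (opD i j f) = -opD i j (swapXY n f) := by
  have h (i j : Fin n) (g : Poly n) : dX (.inr i) (dX (.inl j) g) = dX (.inl j) (dX (.inr i) g) :=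
    LinearMap.congr_fun (dX_comm (.inr i) (.inl j)) g
  rw [opD, LinearMap.sub_apply, LinearMap.sub_apply, map_sub]
  simp only [Module.End.mul_apply, swapXY_dX, Sum.swap_inl, Sum.swap_inr, h]
  rw [neg_sub]

theorem swapXY_minor (i j : Fin n) : swapXY n (minor i j) = -minor i j := by
  simp only [minor, map_sub, map_mul, swapXY_X, Sum.swap_inl, Sum.swap_inr]
  ring

theorem swapXY_opM (i j : Fin n) (f : Poly n) :
    swapXY n (opM i j f) = -opM i j (swapXY n f) := by
  rw [opM_apply, opM_apply, map_mul, swapXY_minor, neg_mul]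

/-- `swapXY` as a linear equivalence. -/
def swapLin (n : ℕ) : Poly n ≃ₗ[ℂ] Poly n := (swapXY n).toLinearEquiv

theorem swapXY_mem_gradedPiece {k l : ℤ} {f : Poly n} (hf : f ∈ gradedPiece n k) (h : -k = l) :
    swapXY n f ∈ gradedPiece n l := by
  subst h
  refine (Submodule.span_le (p := (gradedPiece n (-k)).comap (swapLin n).toLinearMap)).2 ?_ hf
  rintro _ ⟨α, hα, rfl⟩
  refine Submodule.subset_span ⟨α.mapDomain (Equiv.sumComm _ _), ?_, ?_⟩
  · have h1 (a : Idx n) : α.mapDomain (Equiv.sumComm _ _) a.swap = α a :=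
      Finsupp.mapDomain_apply (Equiv.sumComm (Fin n) (Fin n)).injective α a
    have h2 (i : Fin n) : α.mapDomain (Equiv.sumComm _ _) (.inl i) = α (.inr i) := h1 (.inr i)
    have h3 (i : Fin n) : α.mapDomain (Equiv.sumComm _ _) (.inr i) = α (.inl i) := h1 (.inl i)
    simp only [h2, h3, ← hα]
    ring
  · exact MvPolynomial.rename_monomial _ _ _

theorem swapXY_mem_gradedPiece_iff {k : ℤ} {f : Poly n} :
    swapXY n f ∈ gradedPiece n k ↔ f ∈ gradedPiece n (-k) :=
  ⟨fun h => by simpa [swapXY_swapXY] using swapXY_mem_gradedPiece h rfl,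
    fun h => swapXY_mem_gradedPiece h (neg_neg k)⟩

theorem comap_swap_kerη (k : ℤ) : (kerη n (-k)).comap (swapLin n).toLinearMap = kerΔ n k := by
  ext f
  change swapXY n f ∈ gradedPiece n (-k) ∧ η n (swapXY n f) = 0 ↔
    f ∈ gradedPiece n k ∧ Δ n f = 0
  rw [swapXY_mem_gradedPiece_iff, neg_neg, ← neg_eq_zero, ← swapXY_Δ,
    EmbeddingLike.map_eq_zero_iff]

theorem comap_swap_mapΔ (k : ℤ) :
    ((gradedPiece n (-k + 2)).map (Δ n)).comap (swapLin n).toLinearMap =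
      (gradedPiece n (k - 2)).map (η n) := by
  ext f
  constructor
  · rintro ⟨g, hg, h⟩
    refine ⟨-swapXY n g, neg_mem (swapXY_mem_gradedPiece hg (by ring)), ?_⟩
    rw [map_neg, ← swapXY_Δ, h]
    exact swapXY_swapXY f
  · rintro ⟨g, hg, rfl⟩
    refine ⟨-swapXY n g, neg_mem (swapXY_mem_gradedPiece hg (by ring)), ?_⟩
    rw [map_neg, ← swapXY_η]
    rfl

theorem comap_swap_gradedPiece (k : ℤ) :
    (gradedPiece n (-k)).comap (swapLin n).toLinearMap = gradedPiece n k := by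
  ext f
  change swapXY n f ∈ gradedPiece n (-k) ↔ _
  rw [swapXY_mem_gradedPiece_iff, neg_neg]

/-! ### Stable subspaces -/

/-- Subspaces stable under the operators by which `so(2n, ℂ)` acts. -/
structure Stable (S : Submodule ℂ (Poly n)) : Prop where
  opL_mem : ∀ i j, ∀ f ∈ S, opL i j f ∈ S
  opD_mem : ∀ i j, ∀ f ∈ S, opD i j f ∈ S
  opM_mem : ∀ i j, ∀ f ∈ S, opM i j f ∈ S

/-- The exchange intertwines the operators only up to sign, which is enough for subspaces. -/
theorem Stable.comap_swap {S : Submodule ℂ (Poly n)} (hS : Stable S) :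
    Stable (S.comap (swapLin n).toLinearMap) where
  opL_mem i j f hf := by
    change swapXY n _ ∈ S
    rw [swapXY_opL]
    exact hS.opL_mem i j _ hf
  opD_mem i j f hf := by
    change swapXY n _ ∈ S
    rw [swapXY_opD]
    exact S.neg_mem (hS.opD_mem i j _ hf)
  opM_mem i j f hf := by
    change swapXY n _ ∈ S
    rw [swapXY_opM]
    exact S.neg_mem (hS.opM_mem i j _ hf)

theorem stable_gradedPiece (k : ℤ) : Stable (gradedPiece n k) where
  opL_mem i j _ hf := opL_mem_gradedPiece i j hf
  opD_mem i j _ hf := opD_mem_gradedPiece i j hf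
  opM_mem i j _ hf := opM_mem_gradedPiece i j hf

theorem stable_kerη (k : ℤ) : Stable (kerη n k) where
  opL_mem i j f hf := ⟨opL_mem_gradedPiece i j hf.1, by
    have h := LinearMap.congr_fun (η_opL i j) f
    have h0 : η n f = 0 := hf.2
    change η n (opL i j f) = 0
    rw [Module.End.mul_apply, Module.End.mul_apply, h0, map_zero] at h
    exact h⟩
  opD_mem i j f hf := ⟨opD_mem_gradedPiece i j hf.1, by
    have h := LinearMap.congr_fun (η_opD i j) f
    have h0 : η n f = 0 := hf.2
    change η n (opD i j f) = 0
    rw [Module.End.mul_apply, Module.End.mul_apply, h0, map_zero] at h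
    exact h⟩
  opM_mem i j f hf := ⟨opM_mem_gradedPiece i j hf.1, by
    have h := LinearMap.congr_fun (η_opM i j) f
    have h0 : η n f = 0 := hf.2
    change η n (opM i j f) = 0
    rw [Module.End.mul_apply, Module.End.mul_apply, h0, map_zero] at h
    exact h⟩

theorem Stable.map_η {S : Submodule ℂ (Poly n)} (hS : Stable S) : Stable (S.map (η n)) where
  opL_mem i j := by
    rintro _ ⟨f, hf, rfl⟩
    exact ⟨_, hS.opL_mem i j f hf, LinearMap.congr_fun (η_opL i j) f⟩
  opD_mem i j := by
    rintro _ ⟨f, hf, rfl⟩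
    exact ⟨_, hS.opD_mem i j f hf, LinearMap.congr_fun (η_opD i j) f⟩
  opM_mem i j := by
    rintro _ ⟨f, hf, rfl⟩
    exact ⟨_, hS.opM_mem i j f hf, LinearMap.congr_fun (η_opM i j) f⟩

theorem stable_mapη (k : ℤ) : Stable ((gradedPiece n k).map (η n)) :=
  (stable_gradedPiece k).map_η

/-- No commutator with `Δ` is needed: the exchange of variables turns images of `η` into images of
`Δ`. -/
theorem stable_mapΔ (k : ℤ) : Stable ((gradedPiece n k).map (Δ n)) := by
  have h : (gradedPiece n k).map (Δ n) =
      ((gradedPiece n (-k)).map (η n)).comap (swapLin n).toLinearMap := by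
    rw [show -k = (-k + 2) - 2 by ring, ← comap_swap_mapΔ]
    ext f
    change _ ↔ swapXY n (swapXY n f) ∈ (gradedPiece n (-(-k + 2) + 2)).map (Δ n)
    rw [swapXY_swapXY, show -(-k + 2) + 2 = k by ring]
  rw [h]
  exact (stable_mapη _).comap_swap

/-! ### The decomposition under `sl(2)` -/

theorem Δ_η_sub_η_Δ : Δ n * η n - η n * Δ n = eulerY n - eulerX n := by
  have h (i : Fin n) : η n * (mulX (.inl i) * dX (.inr i)) =
      mulX (.inl i) * dX (.inr i) * η n - mulX (.inl i) * dX (.inl i)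
        + mulX (.inr i) * dX (.inr i) := by
    rw [← mul_assoc, η_mulX_inl, add_mul, mul_assoc, η_dX_inr, mul_sub, mul_assoc]
  rw [Δ, mul_neg, neg_mul, Finset.sum_mul, Finset.mul_sum, Finset.sum_congr rfl fun i _ => h i,
    Finset.sum_add_distrib, Finset.sum_sub_distrib, eulerX, eulerY]
  abel

theorem η_Δ_apply {k : ℤ} {f : Poly n} (hf : f ∈ gradedPiece n k) :
    η n (Δ n f) = Δ n (η n f) - (k : ℂ) • f := by
  have h := LinearMap.congr_fun (Δ_η_sub_η_Δ (n := n)) f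
  simp only [LinearMap.sub_apply, Module.End.mul_apply] at h
  have h2 : eulerY n f - eulerX n f = (k : ℂ) • f := by
    ext α
    rw [MvPolynomial.coeff_sub, coeff_eulerX, coeff_eulerY, MvPolynomial.coeff_smul, smul_eq_mul]
    by_cases h0 : f.coeff α = 0
    · simp [h0]
    · rw [← coeff_grade hf h0]
      push_cast
      ring
  rw [← h2, ← h]
  abel

/-- By the `sl(2)` relation, `η h` satisfies the same kind of equation in weight `w + 2`, with the
eigenvalue `c + (w + 2)`, still positive, and with smaller degree in the `x_i`. By induction `η h =
0`, and then `c • h = 0`. -/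
theorem eq_zero_of_Δ_η_eq_smul (m : ℕ) : ∀ {w c : ℤ} {h : Poly n}, 0 ≤ w → 0 < c →
    h ∈ gradedPiece n w → h ∈ weightLT xweight m → Δ n (η n h) = (c : ℂ) • h → h = 0 := by
  induction m with
  | zero => exact fun _ _ _ hm _ => eq_zero_of_mem_weightLT_zero hm
  | succ m ih =>
    intro w c h hw hc hh hm heq
    have hη := η_mem_gradedPiece hh rfl
    have h1 : Δ n (η n (η n h)) = ((c + (w + 2) : ℤ) : ℂ) • η n h := by
      have := η_Δ_apply hη
      rw [heq, map_smul] at this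
      rw [Int.cast_add, add_smul, this]
      abel
    have h2 := ih (by omega) (by omega) hη (η_mem_weightLT hm) h1
    rw [h2, map_zero] at heq
    exact (smul_eq_zero.1 heq.symm).resolve_left (by exact_mod_cast hc.ne')

/-- Surjectivity of `c - Δη`, by the same recursion: if `h'` solves the equation in weight `w + 2`
for the constant `c + (w + 2)` and the right-hand side `η g`, then `η (g + Δ h') = c h'`, so `c⁻¹ (g
+ Δ h')` solves the original one. -/
theorem exists_smul_sub_Δ_η_eq (m : ℕ) : ∀ {w c : ℤ} {g : Poly n}, 0 ≤ w → 0 < c →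
    g ∈ gradedPiece n w → g ∈ weightLT xweight m →
    ∃ h ∈ gradedPiece n w, (c : ℂ) • h - Δ n (η n h) = g := by
  induction m with
  | zero =>
    intro w c g _ _ _ hm
    rw [eq_zero_of_mem_weightLT_zero hm]
    exact ⟨0, zero_mem _, by simp⟩
  | succ m ih =>
    intro w c g hw hc hg hm
    obtain ⟨h, hh, heq⟩ := ih (c := c + (w + 2)) (by omega) (by omega)
      (η_mem_gradedPiece hg rfl) (η_mem_weightLT hm)
    have hc' : (c : ℂ) ≠ 0 := by exact_mod_cast hc.ne'
    refine ⟨(c : ℂ)⁻¹ • (g + Δ n h), Submodule.smul_mem _ _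
      (add_mem hg (Δ_mem_gradedPiece hh rfl)), ?_⟩
    have h1 : η n (g + Δ n h) = (c : ℂ) • h := by
      rw [map_add, η_Δ_apply hh, ← heq, Int.cast_add, add_smul]
      abel
    rw [smul_smul, mul_inv_cancel₀ hc', one_smul, map_smul, map_smul, h1, map_smul, smul_smul,
      inv_mul_cancel₀ hc', one_smul, add_sub_cancel_right]

theorem disjoint_kerη_mapΔ {k : ℤ} (hk : 0 ≤ k) :
    Disjoint (kerη n k) ((gradedPiece n (k + 2)).map (Δ n)) := by
  rw [Submodule.disjoint_def]
  rintro _ ⟨_, h0⟩ ⟨h, hh, rfl⟩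
  obtain ⟨m, hm⟩ := exists_mem_weightLT xweight h
  have h0' : η n (Δ n h) = 0 := h0
  rw [η_Δ_apply hh, sub_eq_zero] at h0'
  rw [eq_zero_of_Δ_η_eq_smul m (by omega) (by omega) hh hm h0', map_zero]

theorem kerη_sup_mapΔ {k : ℤ} (hk : 0 ≤ k) :
    kerη n k ⊔ (gradedPiece n (k + 2)).map (Δ n) = gradedPiece n k := by
  apply le_antisymm
  · refine sup_le inf_le_left ?_
    rintro _ ⟨h, hh, rfl⟩
    exact Δ_mem_gradedPiece hh rfl
  · intro g hg
    -- The condition `η (g - Δ h) = 0` amounts to `(k + 2) h - Δ η h = -η g`, since `h` has weight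
    -- `k + 2`.
    obtain ⟨m, hm⟩ := exists_mem_weightLT xweight (-η n g)
    obtain ⟨h, hh, heq⟩ := exists_smul_sub_Δ_η_eq m (w := k + 2) (c := k + 2) (by omega) (by omega)
      (neg_mem (η_mem_gradedPiece hg rfl)) hm
    refine Submodule.mem_sup.2 ⟨g - Δ n h, ⟨sub_mem hg (Δ_mem_gradedPiece hh rfl), ?_⟩, Δ n h,
      ⟨h, hh, rfl⟩, sub_add_cancel _ _⟩
    change η n (g - Δ n h) = 0
    rw [map_sub, η_Δ_apply hh, ← neg_sub (((k + 2 : ℤ) : ℂ) • h), heq]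
    abel

/-! ### Generation of `𝓗'_⟨k⟩` and its nonzero stable subspaces -/

theorem mem_of_monomial_mem {S : Submodule ℂ (Poly n)} {f : Poly n}
    (h : ∀ α, f.coeff α ≠ 0 → MvPolynomial.monomial α (1 : ℂ) ∈ S) : f ∈ S := by
  rw [f.as_sum]
  refine Submodule.sum_mem _ fun α hα => ?_
  rw [← mul_one (f.coeff α), ← smul_eq_mul, ← MvPolynomial.smul_monomial]
  exact S.smul_mem _ (h α (MvPolynomial.mem_support_iff.1 hα))

/-- `𝓗'_⟨k⟩` is generated by its polynomials in `x_{n+1}, …, x_{2n}` under multiplication by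
minors. -/
theorem kerη_le {k : ℤ} (hk : 0 ≤ k) {S : Submodule ℂ (Poly n)}
    (hM : ∀ i j, ∀ f ∈ S, opM i j f ∈ S)
    (hY : ∀ β : Idx n →₀ ℕ, xdeg β = 0 → (ydeg β : ℤ) = k → MvPolynomial.monomial β (1 : ℂ) ∈ S) :
    kerη n k ≤ S := by
  suffices h : ∀ m, ∀ f ∈ kerη n k, f ∈ weightLT xweight m → f ∈ S by
    intro f hf
    obtain ⟨m, hm⟩ := exists_mem_weightLT xweight f
    exact h m f hf hm
  intro m
  induction m with
  | zero =>
    intro f _ hm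
    rw [eq_zero_of_mem_weightLT_zero hm]
    exact S.zero_mem
  | succ m ih =>
    intro f hf hm
    rcases Nat.eq_zero_or_pos m with rfl | hm0
    · refine mem_of_monomial_mem fun α hα => ?_
      have h1 := hm α hα
      rw [weight_xweight] at h1
      have h2 := coeff_grade hf.1 hα
      exact hY α (by omega) (by omega)
    · set C : Poly n := ∑ i, ∑ j, opM i j (opD i j f) with hC
      have hCS : C ∈ S := S.sum_mem fun i _ => S.sum_mem fun j _ => hM i j _
        (ih _ ((stable_kerη k).opD_mem i j f hf) (opD_mem_weightLT i j hm))
      have hCk : C ∈ kerη n k := (kerη n k).sum_mem fun i _ => (kerη n k).sum_mem fun j _ =>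
        (stable_kerη k).opM_mem i j _ ((stable_kerη k).opD_mem i j f hf)
      have hcap : C = (2 : ℂ) • (eulerX n f + eulerY n (eulerX n f)) :=
        sum_opM_opD_of_η_eq_zero hf.2
      -- This is the Capelli eigenvalue on the top component, where the degree in the `x_i` is `m`
      -- and the degree in the `x_{n+i}` is `m + k`. Hence `c • f - C` loses that component and the
      -- induction applies to it; `C` itself lies in `S` because each `opD i j f` has smaller
      -- degree.
      set c : ℂ := 2 * (m * (m + k + 1)) with hc
      have hc0 : c ≠ 0 := by
        have h1 : (m : ℂ) ≠ 0 := by exact_mod_cast hm0.ne'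
        have h2 : ((m : ℂ) + k + 1) ≠ 0 := by
          have : (m : ℤ) + k + 1 ≠ 0 := by omega
          exact_mod_cast this
        simp [hc, h1, h2]
      have hlow : c • f - C ∈ weightLT xweight m := by
        intro α hα
        have hcoef : (c • f - C).coeff α =
            (c - 2 * (xdeg α + ydeg α * xdeg α)) * f.coeff α := by
          rw [hcap, MvPolynomial.coeff_sub, MvPolynomial.coeff_smul, MvPolynomial.coeff_smul,
            MvPolynomial.coeff_add, coeff_eulerY, coeff_eulerX, smul_eq_mul, smul_eq_mul]
          ring
        rw [hcoef] at hα
        have hfα := right_ne_zero_of_mul hα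
        have h1 := hm α hfα
        rw [weight_xweight] at h1 ⊢
        refine lt_of_le_of_ne (Nat.lt_succ_iff.1 h1) fun heq => left_ne_zero_of_mul hα ?_
        have h2 : ((ydeg α : ℤ) : ℂ) = ((k + xdeg α : ℤ) : ℂ) :=
          congrArg _ (by rw [← coeff_grade hf.1 hfα]; ring)
        push_cast at h2
        rw [h2, hc, ← heq]
        ring
      have h3 := S.add_mem (ih _ ((kerη n k).sub_mem ((kerη n k).smul_mem c hf) hCk) hlow) hCS
      rw [sub_add_cancel] at h3
      exact (S.smul_mem_iff hc0).1 h3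

theorem opL_monomial {β : Idx n →₀ ℕ} (hβ : xdeg β = 0) (i j : Fin n) (c : ℂ) :
    opL i j (MvPolynomial.monomial (β + Finsupp.single (.inr i) 1) c) =
      ((β (.inr i) + 1 : ℕ) : ℂ) • MvPolynomial.monomial (β + Finsupp.single (.inr j) 1) c := by
  have h0 : β (.inl i) = 0 := Finset.sum_eq_zero_iff.1 hβ i (Finset.mem_univ i)
  rw [opL, LinearMap.add_apply, Module.End.mul_apply, Module.End.mul_apply, dX_apply, dX_apply,
    MvPolynomial.pderiv_monomial, MvPolynomial.pderiv_monomial, mulX_apply, mulX_apply]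
  simp only [Finsupp.add_apply, h0, MvPolynomial.X, MvPolynomial.monomial_mul,
    MvPolynomial.smul_monomial]
  simp [add_comm, mul_comm]

/-- The degree in the variables `x_{n+i}` with `i ≠ l`. -/
def weightNe (l : Fin n) : Idx n → ℕ := Sum.elim 0 fun i => if i = l then 0 else 1

theorem ydeg_eq_weightNe (l : Fin n) (α : Idx n →₀ ℕ) :
    ydeg α = Finsupp.weight (weightNe l) α + α (.inr l) := by
  have h : ∀ i, α (.inr i) = α (.inr i) * (if i = l then 0 else 1) +
      (if i = l then α (.inr i) else 0) := by
    intro i; split_ifs <;> simp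
  rw [ydeg, Finset.sum_congr rfl fun i _ => h i, Finset.sum_add_distrib]
  simp [Finsupp.weight_eq_sum, weightNe]

theorem eq_single_of_weightNe_eq_zero {l : Fin n} {α : Idx n →₀ ℕ} (hx : xdeg α = 0)
    (hw : Finsupp.weight (weightNe l) α = 0) : α = Finsupp.single (.inr l) (ydeg α) := by
  rw [ydeg_eq_weightNe l, hw, zero_add]
  ext a
  rcases a with i | i
  · simpa using Finset.sum_eq_zero_iff.1 hx i (Finset.mem_univ i)
  · by_cases h : i = l
    · simp [h]
    · rw [Finsupp.weight_eq_sum] at hw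
      have := Finset.sum_eq_zero_iff.1 hw (.inr i) (Finset.mem_univ _)
      simp only [weightNe, Sum.elim_inr, h, if_false, smul_eq_mul, mul_one] at this
      rw [this, Finsupp.single_eq_of_ne (by simpa using h)]

/-- Up to a nonzero integer, `opL l j` turns one factor `x_{n+l}` into `x_{n+j}`. The induction is
on the number `r` of factors other than `x_{n+l}`. -/
theorem monomial_mem_of_stable {S : Submodule ℂ (Poly n)}
    (hL : ∀ i j, ∀ f ∈ S, opL i j f ∈ S) (l : Fin n) {k : ℕ}
    (hv : MvPolynomial.monomial (Finsupp.single (.inr l) k) (1 : ℂ) ∈ S) (r : ℕ) :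
    ∀ β : Idx n →₀ ℕ, Finsupp.weight (weightNe l) β = r → xdeg β = 0 → ydeg β = k →
      MvPolynomial.monomial β (1 : ℂ) ∈ S := by
  induction r with
  | zero =>
    intro β hw hx hy
    rw [eq_single_of_weightNe_eq_zero hx hw, hy]
    exact hv
  | succ r ih =>
    intro β hw hx hy
    have h0 : ∃ j, j ≠ l ∧ β (.inr j) ≠ 0 := by
      by_contra! h
      have : Finsupp.weight (weightNe l) β = 0 := by
        rw [Finsupp.weight_eq_sum]
        refine Finset.sum_eq_zero fun a _ => ?_
        rcases a with i | i
        · simp [weightNe]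
        · by_cases hi : i = l
          · simp [weightNe, hi]
          · simp [h i hi]
      omega
    obtain ⟨j, hj, hβj⟩ := h0
    obtain ⟨γ, rfl⟩ : ∃ γ, β = γ + Finsupp.single (.inr j) 1 :=
      ⟨β - Finsupp.single (.inr j) 1, (tsub_add_cancel_of_le
        (by simpa [Finsupp.single_le_iff, Nat.one_le_iff_ne_zero] using hβj)).symm⟩
    have hxγ : xdeg γ = 0 := by simpa [xdeg] using hx
    have hyγ (i : Fin n) : ydeg (γ + Finsupp.single (.inr i) 1) = ydeg γ + 1 := by
      simp [ydeg, Finset.sum_add_distrib, Finsupp.single_apply]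
    have hmem := ih (γ + Finsupp.single (.inr l) 1)
      (by simpa [weightNe, Finsupp.weight_single, hj] using hw) (by simpa [xdeg] using hx)
      (by rw [hyγ] at *; exact hy)
    have h1 := hL l j _ hmem
    rw [opL_monomial hxγ] at h1
    exact (S.smul_mem_iff (Nat.cast_ne_zero.2 (Nat.succ_ne_zero _))).1 h1

theorem kerη_le_of_stable {k : ℤ} (hk : 0 ≤ k) (l : Fin n) {S : Submodule ℂ (Poly n)}
    (hS : Stable S) (hv : MvPolynomial.X (.inr l) ^ k.toNat ∈ S) : kerη n k ≤ S := by
  rw [MvPolynomial.X_pow_eq_monomial] at hv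
  exact kerη_le hk hS.opM_mem fun β hx hy =>
    monomial_mem_of_stable hS.opL_mem l hv _ β rfl hx (by omega)

/-- The way back: for `i ≠ l`, `opL i l` turns factors `x_{n+i}` into `x_{n+l}` and so lowers the
degree in the other variables. If all of these kill `f`, then `f` depends on `x_{n+l}` alone and is
a multiple of the required power. -/
theorem X_pow_mem_of_pure {k : ℤ} (l : Fin n) {S : Submodule ℂ (Poly n)}
    (hS : Stable S) (m : ℕ) : ∀ f ∈ S, f ∈ gradedPiece n k → f ≠ 0 →
      (∀ α, f.coeff α ≠ 0 → xdeg α = 0) → f ∈ weightLT (weightNe l) m →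
      MvPolynomial.X (.inr l) ^ k.toNat ∈ S := by
  induction m with
  | zero => exact fun f _ _ h0 _ hm => absurd (eq_zero_of_mem_weightLT_zero hm) h0
  | succ m ih =>
    intro f hf hfk h0 hx hm
    have hdx (i : Fin n) : dX (.inl i) f = 0 := by
      ext α
      by_contra h
      have h1 := hx _ (coeff_of_coeff_dX_ne_zero (by simpa using h))
      have := Finset.sum_eq_zero_iff.1 h1 i (Finset.mem_univ i)
      simp at this
    have hL (i j : Fin n) : opL i j f = mulX (.inr j) (dX (.inr i) f) := by
      rw [opL, LinearMap.add_apply, Module.End.mul_apply, Module.End.mul_apply, hdx, map_zero,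
        zero_add]
    by_cases hall : ∀ i, i ≠ l → opL i l f = 0
    · have hsupp (α) (hα : f.coeff α ≠ 0) : α = Finsupp.single (.inr l) k.toNat := by
        have h1 (i : Fin n) (hi : i ≠ l) : α (.inr i) = 0 := by
          have h2 := hall i hi
          rw [hL, mulX_apply] at h2
          have h3 := (mul_eq_zero.1 h2).resolve_left (MvPolynomial.X_ne_zero _)
          have h4 := coeff_mulX_dX (.inr i) f α
          rw [h3, map_zero, MvPolynomial.coeff_zero] at h4
          exact_mod_cast (mul_eq_zero.1 h4.symm).resolve_right hα
        have h5 := eq_single_of_weightNe_eq_zero (l := l) (hx α hα) (by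
          rw [Finsupp.weight_eq_sum]
          refine Finset.sum_eq_zero fun a _ => ?_
          rcases a with i | i
          · simp [weightNe]
          · by_cases hi : i = l
            · simp [weightNe, hi]
            · simp [h1 i hi])
        have h6 := coeff_grade hfk hα
        rw [hx α hα] at h6
        rw [h5]
        congr 1
        omega
      obtain ⟨α, hα⟩ := MvPolynomial.ne_zero_iff.1 h0
      have hfeq : f = f.coeff α • MvPolynomial.X (.inr l) ^ k.toNat := by
        ext β
        rw [MvPolynomial.X_pow_eq_monomial, MvPolynomial.coeff_smul, MvPolynomial.coeff_monomial,
          ← hsupp α hα]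
        by_cases hβ : f.coeff β = 0
        · rw [hβ]
          split_ifs with h
          · exact absurd (h ▸ hβ) hα
          · simp
        · rw [hsupp β hβ, ← hsupp α hα]
          simp
      rw [hfeq] at hf
      exact (S.smul_mem_iff hα).1 hf
    · push Not at hall
      obtain ⟨i, hi, hne⟩ := hall
      refine ih _ (hS.opL_mem i l f hf) (opL_mem_gradedPiece i l hfk) hne ?_ ?_
      · intro α hα
        rw [hL] at hα
        obtain ⟨β, rfl, hβ⟩ := coeff_of_coeff_mulX_ne_zero hα
        have := hx _ (coeff_of_coeff_dX_ne_zero hβ)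
        simpa [xdeg] using this
      · rw [hL]
        have h1 := mulX_mem_weightLT (w := weightNe l) (.inr l)
          (dX_mem_weightLT (w := weightNe l) (m := m) (.inr i) (by simpa [weightNe, hi] using hm))
        simpa [weightNe] using h1

/-- A nonzero stable subspace of `𝓗'_⟨k⟩` contains the highest weight vector. -/
theorem X_pow_mem_of_stable {k : ℤ} (l : Fin n) {S : Submodule ℂ (Poly n)}
    (hS : Stable S) (hle : S ≤ kerη n k) (h0 : S ≠ ⊥) :
    MvPolynomial.X (.inr l) ^ k.toNat ∈ S := by
  suffices h : ∀ m, ∀ f ∈ S, f ≠ 0 → f ∈ weightLT xweight m →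
      MvPolynomial.X (.inr l) ^ k.toNat ∈ S by
    obtain ⟨f, hf, hf0⟩ := S.ne_bot_iff.1 h0
    obtain ⟨m, hm⟩ := exists_mem_weightLT xweight f
    exact h m f hf hf0 hm
  intro m
  induction m with
  | zero => exact fun f _ h0 hm => absurd (eq_zero_of_mem_weightLT_zero hm) h0
  | succ m ih =>
    intro f hf hf0 hm
    -- If every `opD` kills `f`, the Capelli identity gives `xdeg α * (ydeg α + 1) = 0` for each
    -- monomial of `f`, so no `x_i` occurs. Otherwise some `opD i j f` is nonzero of smaller degree.
    by_cases hall : ∀ i j, opD i j f = 0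
    · have hcap := sum_opM_opD_of_η_eq_zero (hle hf).2
      simp only [hall, map_zero, Finset.sum_const_zero] at hcap
      have hx (α) (hα : f.coeff α ≠ 0) : xdeg α = 0 := by
        have h1 := congrArg (MvPolynomial.coeff α) hcap
        rw [MvPolynomial.coeff_smul, MvPolynomial.coeff_add, coeff_eulerY, coeff_eulerX,
          MvPolynomial.coeff_zero, smul_eq_mul] at h1
        have h2 : ((xdeg α * (ydeg α + 1) : ℕ) : ℂ) * (2 * f.coeff α) = 0 := by
          rw [h1]; push_cast; ring
        have h3 := (mul_eq_zero.1 h2).resolve_right (mul_ne_zero two_ne_zero hα)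
        exact (mul_eq_zero.1 (Nat.cast_eq_zero.1 h3)).resolve_right (Nat.succ_ne_zero _)
      obtain ⟨m', hm'⟩ := exists_mem_weightLT (weightNe l) f
      exact X_pow_mem_of_pure l hS m' f hf (hle hf).1 hf0 hx hm'
    · push Not at hall
      obtain ⟨i, j, hne⟩ := hall
      exact ih _ (hS.opD_mem i j f hf) hne (opD_mem_weightLT i j hm)

/-! ### Straightening -/

/-- The product `∏ x_{n+t}^{k_t} ∏_{i<j} (x_i x_{n+j} - x_j x_{n+i})^{k_{i,j}}`. -/
def yMinorProd (τ : Fin n → ℕ) (κ : Pair n → ℕ) : Poly n :=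
  (∏ t, MvPolynomial.X (.inr t) ^ τ t) * minorProd κ

/-- The conditions `k_{i,j} k_t = 0` for `i < j < t` and `k_{i,j} k_{i₁,j₁} = 0` for `i < i₁` and
`j > j₁`. -/
def Noncrossing (τ : Fin n → ℕ) (κ : Pair n → ℕ) : Prop :=
  (∀ (p : Pair n) (t : Fin n), p.1.2 < t → κ p * τ t = 0) ∧
    (∀ p q : Pair n, p.1.1 < q.1.1 → q.1.2 < p.1.2 → κ p * κ q = 0)

theorem minorProd_add (κ κ' : Pair n → ℕ) :
    minorProd (κ + κ') = minorProd κ * minorProd κ' := by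
  simp only [minorProd, Pi.add_apply, pow_add, Finset.prod_mul_distrib]

theorem minorProd_single (p : Pair n) : minorProd (Pi.single p 1) = minor p.1.1 p.1.2 := by
  rw [minorProd, Finset.prod_eq_single p]
  · simp [minor]
  · intro q _ hq
    simp [Pi.single_eq_of_ne hq]
  · simp

theorem yMinorProd_add (τ τ' : Fin n → ℕ) (κ κ' : Pair n → ℕ) :
    yMinorProd (τ + τ') (κ + κ') = yMinorProd τ κ * yMinorProd τ' κ' := by
  simp only [yMinorProd, minorProd_add, Pi.add_apply, pow_add, Finset.prod_mul_distrib]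
  ring

theorem yMinorProd_single_zero (t : Fin n) :
    yMinorProd (Pi.single t 1) 0 = MvPolynomial.X (.inr t) := by
  rw [yMinorProd, Finset.prod_eq_single t]
  · simp [minorProd]
  · intro s _ hs
    simp [Pi.single_eq_of_ne hs]
  · simp

theorem yMinorProd_zero_single (p : Pair n) :
    yMinorProd 0 (Pi.single p 1) = minor p.1.1 p.1.2 := by
  simp [yMinorProd, minorProd_single]

theorem yMinorProd_add_single (τ : Fin n → ℕ) (κ : Pair n → ℕ) (t : Fin n) (p : Pair n) :
    yMinorProd (τ + Pi.single t 1) (κ + Pi.single p 1) =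
      yMinorProd τ κ * (MvPolynomial.X (.inr t) * minor p.1.1 p.1.2) := by
  have h : yMinorProd (Pi.single t 1) (Pi.single p 1) =
      MvPolynomial.X (.inr t) * minor p.1.1 p.1.2 := by
    rw [← yMinorProd_single_zero, ← yMinorProd_zero_single, ← yMinorProd_add, add_zero, zero_add]
  rw [yMinorProd_add, h]

theorem yMinorProd_add_single_single (τ : Fin n → ℕ) (κ : Pair n → ℕ) (p q : Pair n) :
    yMinorProd τ (κ + Pi.single p 1 + Pi.single q 1) =
      yMinorProd τ κ * (minor p.1.1 p.1.2 * minor q.1.1 q.1.2) := by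
  rw [← yMinorProd_zero_single, ← yMinorProd_zero_single, ← yMinorProd_add, ← yMinorProd_add,
    add_zero, add_zero, add_assoc]

/-- The quantity that decreases under straightening. -/
def spread (τ : Fin n → ℕ) (κ : Pair n → ℕ) : ℕ :=
  ∑ t, τ t * (t + 1) ^ 2 + ∑ p, κ p * (p.1.2 - p.1.1) ^ 2

theorem spread_add (τ τ' : Fin n → ℕ) (κ κ' : Pair n → ℕ) :
    spread (τ + τ') (κ + κ') = spread τ κ + spread τ' κ' := by
  simp only [spread, Pi.add_apply, add_mul, Finset.sum_add_distrib]
  ring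

theorem spread_single_zero (t : Fin n) : spread (Pi.single t 1) 0 = (t + 1) ^ 2 := by
  rw [spread, Finset.sum_eq_single t]
  · simp
  · intro s _ hs
    simp [Pi.single_eq_of_ne hs]
  · simp

theorem spread_zero_single (p : Pair n) : spread 0 (Pi.single p 1) = (p.1.2 - p.1.1 : ℕ) ^ 2 := by
  rw [spread, Finset.sum_eq_single p]
  · simp
  · intro s _ hs
    simp [Pi.single_eq_of_ne hs]
  · simp

theorem spread_add_single (τ : Fin n → ℕ) (κ : Pair n → ℕ) (t : Fin n) (p : Pair n) :
    spread (τ + Pi.single t 1) (κ + Pi.single p 1) =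
      spread τ κ + ((t + 1) ^ 2 + (p.1.2 - p.1.1 : ℕ) ^ 2) := by
  rw [← spread_single_zero, ← spread_zero_single, ← spread_add, ← spread_add, add_zero, zero_add]

theorem spread_add_single_single (τ : Fin n → ℕ) (κ : Pair n → ℕ) (p q : Pair n) :
    spread τ (κ + Pi.single p 1 + Pi.single q 1) =
      spread τ κ + ((p.1.2 - p.1.1 : ℕ) ^ 2 + (q.1.2 - q.1.1 : ℕ) ^ 2) := by
  rw [← spread_zero_single, ← spread_zero_single, ← spread_add, ← spread_add,
    add_zero, add_zero, add_assoc]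

theorem exists_eq_add_single {ι : Type*} [DecidableEq ι] {κ : ι → ℕ} {p : ι} (h : κ p ≠ 0) :
    ∃ κ₀, κ = κ₀ + (Pi.single p 1 : ι → ℕ) := by
  refine ⟨κ - (Pi.single p 1 : ι → ℕ), (tsub_add_cancel_of_le fun q => ?_).symm⟩
  by_cases hq : q = p
  · subst hq
    simpa [Nat.one_le_iff_ne_zero] using h
  · simp [Pi.single_eq_of_ne hq]

theorem sum_add_single (τ : Fin n → ℕ) (t : Fin n) :
    ∑ s, (τ + (Pi.single t 1 : Fin n → ℕ)) s = ∑ s, τ s + 1 := by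
  simp [Finset.sum_add_distrib]

/-- Adjoin a column with index `-1` and entries `(1, 0)`: then `x_{n+t}` is the minor of the columns
`-1` and `t`, and both conditions in `Noncrossing` forbid strictly nested pairs. The relation
`[ad][bc] = [ac][bd] - [ab][cd]` for `a < b < c < d` removes a nesting, and each new term has a
smaller sum of squared widths. This explains `(t + 1) ^ 2` in `spread`, with 0-based indices. -/
theorem yMinorProd_mem {S : Submodule ℂ (Poly n)} {d : ℕ}
    (hS : ∀ τ κ, ∑ t, τ t = d → Noncrossing τ κ → yMinorProd τ κ ∈ S) (N : ℕ) :
    ∀ τ κ, spread τ κ = N → ∑ t, τ t = d → yMinorProd τ κ ∈ S := by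
  induction N using Nat.strong_induction_on with
  | _ N ih =>
    intro τ κ hN hd
    by_cases hstd : Noncrossing τ κ
    · exact hS τ κ hd hstd
    rw [Noncrossing, not_and_or] at hstd
    rcases hstd with h | h
    · push Not at h
      obtain ⟨⟨⟨i, j⟩, hij⟩, t, hjt, h0⟩ := h
      obtain ⟨κ, rfl⟩ := exists_eq_add_single (left_ne_zero_of_mul h0)
      obtain ⟨τ, rfl⟩ := exists_eq_add_single (right_ne_zero_of_mul h0)
      simp only at hij hjt
      rw [sum_add_single] at hd
      rw [spread_add_single] at hN
      -- The Plücker relation for the columns `-1 < i < j < t`.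
      have e : yMinorProd (τ + Pi.single t 1) (κ + Pi.single ⟨(i, j), hij⟩ 1) =
          yMinorProd (τ + Pi.single j 1) (κ + Pi.single ⟨(i, t), hij.trans hjt⟩ 1) -
          yMinorProd (τ + Pi.single i 1) (κ + Pi.single ⟨(j, t), hjt⟩ 1) := by
        simp only [yMinorProd_add_single, minor]
        ring
      obtain ⟨u, hu⟩ := Nat.exists_eq_add_of_lt (Fin.lt_def.1 hij)
      obtain ⟨v, hv⟩ := Nat.exists_eq_add_of_lt (Fin.lt_def.1 hjt)
      rw [e]
      refine S.sub_mem (ih _ ?_ _ _ rfl (by rw [sum_add_single, hd]))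
        (ih _ ?_ _ _ rfl (by rw [sum_add_single, hd]))
      all_goals
        rw [spread_add_single, ← hN]
        refine Nat.add_lt_add_left ?_ _
        simp only
        have e1 : (j : ℕ) - i = u + 1 := by omega
        have e2 : (t : ℕ) - i = u + v + 2 := by omega
        have e3 : (t : ℕ) - j = v + 1 := by omega
        have e4 : (t : ℕ) = i + u + v + 2 := by omega
        have e5 : (j : ℕ) = i + u + 1 := by omega
        simp only [e1, e2, e3]
        rw [e4]
        try rw [e5]
        nlinarith [Nat.zero_le ((i : ℕ) * u), Nat.zero_le ((i : ℕ) * v), Nat.zero_le (u * v)]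
    · push Not at h
      obtain ⟨⟨⟨a, d'⟩, had⟩, ⟨⟨b, c⟩, hbc⟩, hab, hcd, h0⟩ := h
      simp only at had hbc hab hcd
      have hq := right_ne_zero_of_mul h0
      obtain ⟨κ, rfl⟩ := exists_eq_add_single (left_ne_zero_of_mul h0)
      rw [Pi.add_apply, Pi.single_eq_of_ne (by
        intro h
        simp only [Subtype.mk.injEq, Prod.mk.injEq] at h
        exact hab.ne' h.1), add_zero] at hq
      obtain ⟨κ, rfl⟩ := exists_eq_add_single hq
      rw [spread_add_single_single] at hN
      have hac := hab.trans hbc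
      have hbd := hbc.trans hcd
      have e : yMinorProd τ (κ + Pi.single ⟨(b, c), hbc⟩ 1 + Pi.single ⟨(a, d'), had⟩ 1) =
          yMinorProd τ (κ + Pi.single ⟨(a, c), hac⟩ 1 + Pi.single ⟨(b, d'), hbd⟩ 1) -
          yMinorProd τ (κ + Pi.single ⟨(a, b), hab⟩ 1 + Pi.single ⟨(c, d'), hcd⟩ 1) := by
        simp only [yMinorProd_add_single_single, minor]
        ring
      obtain ⟨u, hu⟩ := Nat.exists_eq_add_of_lt (Fin.lt_def.1 hab)
      obtain ⟨v, hv⟩ := Nat.exists_eq_add_of_lt (Fin.lt_def.1 hbc)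
      obtain ⟨w, hw⟩ := Nat.exists_eq_add_of_lt (Fin.lt_def.1 hcd)
      rw [e]
      refine S.sub_mem (ih _ ?_ _ _ rfl hd) (ih _ ?_ _ _ rfl hd)
      all_goals
        rw [spread_add_single_single, ← hN]
        refine Nat.add_lt_add_left ?_ _
        simp only
        have e1 : (b : ℕ) - a = u + 1 := by omega
        have e2 : (c : ℕ) - b = v + 1 := by omega
        have e3 : (d' : ℕ) - c = w + 1 := by omega
        have e4 : (c : ℕ) - a = u + v + 2 := by omega
        have e5 : (d' : ℕ) - b = v + w + 2 := by omega
        have e6 : (d' : ℕ) - a = u + v + w + 3 := by omega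
        simp only [e1, e2, e3, e4, e5, e6]
        nlinarith [Nat.zero_le (u * v), Nat.zero_le (u * w), Nat.zero_le (v * w)]

theorem minor_swap (i j : Fin n) : minor j i = -minor i j := by
  simp only [minor]; ring

theorem minor_self (i : Fin n) : minor i i = 0 := by simp [minor]

theorem monomial_eq_yMinorProd {β : Idx n →₀ ℕ} (h : xdeg β = 0) :
    MvPolynomial.monomial β (1 : ℂ) = yMinorProd (fun t => β (.inr t)) 0 := by
  rw [MvPolynomial.monomial_eq, Finsupp.prod_fintype _ _ (by simp), Fintype.prod_sum_type]
  have h0 (i : Fin n) : β (.inl i) = 0 := Finset.sum_eq_zero_iff.1 h i (Finset.mem_univ i)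
  simp [h0, yMinorProd, minorProd]

theorem kerη_le_span {k : ℤ} (hk : 0 ≤ k) :
    kerη n k ≤ Submodule.span ℂ (Set.range (basisη : NoncrossingExp n k → Poly n)) := by
  set B := Submodule.span ℂ (Set.range (basisη : NoncrossingExp n k → Poly n)) with hB
  have hmem (τ : Fin n → ℕ) (κ : Pair n → ℕ) (h : ∑ t, τ t = k.toNat) : yMinorProd τ κ ∈ B := by
    refine yMinorProd_mem (fun τ κ hd hstd => ?_) _ τ κ rfl h
    refine Submodule.subset_span ⟨⟨(τ, κ), ?_, hstd⟩, rfl⟩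
    rw [← Nat.cast_sum, hd, Int.toNat_of_nonneg hk]
  -- Products with arbitrary exponents are stable under multiplication by minors, so `kerη_le`
  -- applies to their span; straightening then reduces to admissible exponents.
  set T := {f | ∃ τ κ, ∑ t, τ t = k.toNat ∧ f = yMinorProd (n := n) τ κ} with hT
  have hTB : Submodule.span ℂ T ≤ B := by
    refine Submodule.span_le.2 ?_
    rintro _ ⟨τ, κ, h, rfl⟩
    exact hmem τ κ h
  refine le_trans (kerη_le hk ?_ ?_) hTB
  · intro i j f hf
    have hlt {i j : Fin n} (hij : i < j) : opM i j f ∈ Submodule.span ℂ T := by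
      refine (Submodule.span_le (p := (Submodule.span ℂ T).comap (opM i j))).2 ?_ hf
      rintro _ ⟨τ, κ, h, rfl⟩
      refine Submodule.subset_span ⟨τ, κ + Pi.single ⟨(i, j), hij⟩ 1, h, ?_⟩
      rw [opM_apply, mul_comm, ← yMinorProd_zero_single ⟨(i, j), hij⟩, ← yMinorProd_add, add_zero]
    rcases lt_trichotomy i j with h | rfl | h
    · exact hlt h
    · rw [opM_apply, minor_self, zero_mul]
      exact Submodule.zero_mem _
    · rw [opM_apply, minor_swap, neg_mul, ← opM_apply]
      exact Submodule.neg_mem _ (hlt h)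
  · intro β hx hy
    exact Submodule.subset_span ⟨_, 0, by rw [← hy]; rfl, monomial_eq_yMinorProd hx⟩

/-! ### Products of the `x_{n+t}` and minors are killed by the derivation `η` -/

theorem η_mul (f g : Poly n) : η n (f * g) = η n f * g + f * η n g := by
  simp only [η, LinearMap.sum_apply, Module.End.mul_apply, mulX_apply, dX_apply,
    MvPolynomial.pderiv_mul, Finset.sum_mul, Finset.mul_sum, ← Finset.sum_add_distrib]
  exact Finset.sum_congr rfl fun i _ => by ring

theorem mul_mem_kerη {k l m : ℤ} {f g : Poly n} (hf : f ∈ kerη n k) (hg : g ∈ kerη n l)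
    (h : k + l = m) : f * g ∈ kerη n m := by
  refine ⟨mul_mem_gradedPiece hf.1 hg.1 h, ?_⟩
  have h1 : η n f = 0 := hf.2
  have h2 : η n g = 0 := hg.2
  change η n (f * g) = 0
  rw [η_mul, h1, h2, zero_mul, mul_zero, add_zero]

theorem one_mem_kerη : (1 : Poly n) ∈ kerη n 0 := by
  refine ⟨mem_gradedPiece.2 (MvPolynomial.isWeightedHomogeneous_one _ _), ?_⟩
  have h := η_mul (1 : Poly n) 1
  rw [one_mul, one_mul, mul_one] at h
  exact left_eq_add.1 h

theorem pow_mem_kerη {k : ℤ} {f : Poly n} (hf : f ∈ kerη n k) (m : ℕ) :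
    f ^ m ∈ kerη n (m * k) := by
  induction m with
  | zero => simpa using one_mem_kerη
  | succ m ih =>
    rw [pow_succ]
    exact mul_mem_kerη ih hf (by push_cast; ring)

theorem prod_mem_kerη {ι : Type*} (s : Finset ι) {k : ι → ℤ} {f : ι → Poly n}
    (hf : ∀ i ∈ s, f i ∈ kerη n (k i)) : ∏ i ∈ s, f i ∈ kerη n (∑ i ∈ s, k i) := by
  classical
  induction s using Finset.induction_on with
  | empty => simpa using one_mem_kerη
  | insert a s ha ih =>
    rw [Finset.prod_insert ha, Finset.sum_insert ha]
    exact mul_mem_kerη (hf a (Finset.mem_insert_self _ _))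
      (ih fun i hi => hf i (Finset.mem_insert_of_mem hi)) rfl

theorem X_inr_mem_kerη (t : Fin n) : MvPolynomial.X (.inr t) ∈ kerη n 1 := by
  refine ⟨X_mem_gradedPiece (.inr t), ?_⟩
  have h := LinearMap.congr_fun (η_mulX_inr t) (1 : Poly n)
  have h1 : η n (1 : Poly n) = 0 := one_mem_kerη.2
  simpa [mulX_apply, h1] using h

theorem minor_mem_kerη (i j : Fin n) : minor i j ∈ kerη n 0 := by
  rw [← mul_one (minor i j), ← opM_apply]
  exact (stable_kerη 0).opM_mem i j _ one_mem_kerη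

theorem yMinorProd_mem_kerη (τ : Fin n → ℕ) (κ : Pair n → ℕ) :
    yMinorProd τ κ ∈ kerη n (∑ t, (τ t : ℤ)) := by
  have h1 := prod_mem_kerη Finset.univ (k := fun t => (τ t : ℤ) * 1)
    (f := fun t => (MvPolynomial.X (.inr t) : Poly n) ^ τ t) fun t _ => pow_mem_kerη (X_inr_mem_kerη t) (τ t)
  have h2 := prod_mem_kerη Finset.univ (k := fun p => (κ p : ℤ) * 0)
    (f := fun p : Pair n => minor p.1.1 p.1.2 ^ κ p)
    fun p _ => pow_mem_kerη (minor_mem_kerη p.1.1 p.1.2) (κ p)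
  exact mul_mem_kerη h1 h2 (by simp)

theorem basisη_mem_kerη {k : ℤ} (e : NoncrossingExp n k) : basisη e ∈ kerη n k := by
  have h := yMinorProd_mem_kerη e.1.1 e.1.2
  rw [show ∑ t, (e.1.1 t : ℤ) = k from e.2.1] at h
  exact h

theorem span_basisη {k : ℤ} (hk : 0 ≤ k) :
    Submodule.span ℂ (Set.range (basisη : NoncrossingExp n k → Poly n)) = kerη n k := by
  refine le_antisymm (Submodule.span_le.2 ?_) (kerη_le_span hk)
  rintro _ ⟨e, rfl⟩
  exact basisη_mem_kerη e

/-! ### Leading monomials -/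

/-- `f` is the monomial `x^α` plus terms of smaller `w`-weight. -/
def HasLead (w : Idx n → ℕ) (f : Poly n) (α : Idx n →₀ ℕ) : Prop :=
  f - MvPolynomial.monomial α 1 ∈ weightLT w (Finsupp.weight w α)

/-- The bound `b + 1` on `g` means weight at most `b`: only one factor has to be strictly below its
bound. -/
theorem mul_mem_weightLT {w : Idx n → ℕ} {a b : ℕ} {f g : Poly n} (hf : f ∈ weightLT w a)
    (hg : g ∈ weightLT w (b + 1)) : f * g ∈ weightLT w (a + b) := by
  intro α hα
  rw [MvPolynomial.coeff_mul] at hα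
  obtain ⟨⟨β, γ⟩, hmem, hne⟩ := Finset.exists_ne_zero_of_sum_ne_zero hα
  rw [← Finset.HasAntidiagonal.mem_antidiagonal.1 hmem, map_add]
  have h1 := hf β (left_ne_zero_of_mul hne)
  have h2 := hg γ (right_ne_zero_of_mul hne)
  simp only
  omega

theorem monomial_mem_weightLT (w : Idx n → ℕ) {m : ℕ} {α : Idx n →₀ ℕ}
    (h : Finsupp.weight w α < m) (c : ℂ) : MvPolynomial.monomial α c ∈ weightLT w m := by
  intro β hβ
  rw [MvPolynomial.coeff_monomial] at hβ
  split_ifs at hβ with hαβ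
  · exact hαβ ▸ h
  · exact absurd rfl hβ

theorem weightLT_mono (w : Idx n → ℕ) {a b : ℕ} (h : a ≤ b) : weightLT w a ≤ weightLT w b :=
  fun _ hf α hα => (hf α hα).trans_le h

theorem HasLead.mem_weightLT {w : Idx n → ℕ} {f : Poly n} {α : Idx n →₀ ℕ} (h : HasLead w f α) :
    f ∈ weightLT w (Finsupp.weight w α + 1) := by
  rw [← sub_add_cancel f (MvPolynomial.monomial α 1)]
  exact (weightLT w _).add_mem (weightLT_mono w (Nat.le_succ _) h)
    (monomial_mem_weightLT w (Nat.lt_succ_self _) 1)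

theorem HasLead.mul {w : Idx n → ℕ} {f g : Poly n} {α β : Idx n →₀ ℕ} (hf : HasLead w f α)
    (hg : HasLead w g β) : HasLead w (f * g) (α + β) := by
  have e : f * g - MvPolynomial.monomial (α + β) 1 =
      (f - MvPolynomial.monomial α 1) * g +
        (g - MvPolynomial.monomial β 1) * MvPolynomial.monomial α 1 := by
    have : MvPolynomial.monomial (α + β) (1 : ℂ) =
        MvPolynomial.monomial α 1 * MvPolynomial.monomial β 1 := by
      rw [MvPolynomial.monomial_mul, one_mul]
    rw [this]
    ring
  rw [HasLead, e, map_add]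
  refine (weightLT w _).add_mem (mul_mem_weightLT hf hg.mem_weightLT) ?_
  rw [add_comm]
  exact mul_mem_weightLT hg (monomial_mem_weightLT w (Nat.lt_succ_self _) 1)

theorem hasLead_monomial (w : Idx n → ℕ) (α : Idx n →₀ ℕ) :
    HasLead w (MvPolynomial.monomial α 1) α := by
  rw [HasLead, sub_self]
  exact (weightLT w _).zero_mem

theorem HasLead.pow {w : Idx n → ℕ} {f : Poly n} {α : Idx n →₀ ℕ} (hf : HasLead w f α) (m : ℕ) :
    HasLead w (f ^ m) (m • α) := by
  induction m with
  | zero => simpa using hasLead_monomial w 0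
  | succ m ih =>
    rw [pow_succ, succ_nsmul]
    exact ih.mul hf

theorem HasLead.prod {w : Idx n → ℕ} {ι : Type*} (s : Finset ι) {f : ι → Poly n}
    {α : ι → Idx n →₀ ℕ} (hf : ∀ i ∈ s, HasLead w (f i) (α i)) :
    HasLead w (∏ i ∈ s, f i) (∑ i ∈ s, α i) := by
  classical
  induction s using Finset.induction_on with
  | empty => simpa using hasLead_monomial w 0
  | insert a s ha ih =>
    rw [Finset.prod_insert ha, Finset.sum_insert ha]
    exact (hf a (Finset.mem_insert_self _ _)).mul
      (ih fun i hi => hf i (Finset.mem_insert_of_mem hi))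

/-- The weight need not separate monomials. At an index of maximal weight in a relation, all
remainders contribute nothing to the coefficient of its leading monomial, and the other leading
monomials differ from it. -/
theorem linearIndependent_of_hasLead {w : Idx n → ℕ} {ι : Type*} {v : ι → Poly n}
    {α : ι → Idx n →₀ ℕ} (hα : Function.Injective α) (h : ∀ i, HasLead w (v i) (α i)) :
    LinearIndependent ℂ v := by
  classical
  rw [linearIndependent_iff]
  intro l hl
  by_contra hne
  obtain ⟨e, he, hmax⟩ := Finset.exists_max_image l.support (fun i => Finsupp.weight w (α i))
    (Finsupp.support_nonempty_iff.2 hne)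
  have hcoef (i) (hi : i ∈ l.support) : (v i).coeff (α e) = if i = e then 1 else 0 := by
    have h1 : (v i - MvPolynomial.monomial (α i) 1).coeff (α e) = 0 := by
      by_contra h2
      exact absurd (h i _ h2) (not_lt.2 (hmax i hi))
    rw [MvPolynomial.coeff_sub, sub_eq_zero] at h1
    rw [h1, MvPolynomial.coeff_monomial]
    simp only [hα.eq_iff]
  have h0 := congrArg (MvPolynomial.coeff (α e)) hl
  rw [Finsupp.linearCombination_apply, Finsupp.sum, MvPolynomial.coeff_sum,
    Finset.sum_eq_single e, MvPolynomial.coeff_smul, hcoef e he, if_pos rfl,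
    MvPolynomial.coeff_zero] at h0
  · exact Finsupp.mem_support_iff.1 he (by simpa using h0)
  · intro i hi hie
    rw [MvPolynomial.coeff_smul, hcoef i hi, if_neg hie, smul_zero]
  · exact fun h => absurd he h

/-- A weight for which `x_i x_{n+j}` is the leading term of a minor with `i < j`. -/
def leadWeight : Idx n → ℕ := Sum.elim 0 fun j => j

theorem hasLead_X (w : Idx n → ℕ) (a : Idx n) :
    HasLead w (MvPolynomial.X a) (Finsupp.single a 1) := hasLead_monomial w _

theorem hasLead_minor {i j : Fin n} (hij : i < j) :
    HasLead leadWeight (minor i j) (Finsupp.single (.inl i) 1 + Finsupp.single (.inr j) 1) := by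
  have e : minor i j - MvPolynomial.monomial
      (Finsupp.single (.inl i) 1 + Finsupp.single (.inr j) 1) (1 : ℂ) =
      -MvPolynomial.monomial (Finsupp.single (.inl j) 1 + Finsupp.single (.inr i) 1) (1 : ℂ) := by
    simp only [minor, MvPolynomial.X, MvPolynomial.monomial_mul, one_mul]
    ring
  rw [HasLead, e]
  refine (weightLT _ _).neg_mem (monomial_mem_weightLT _ ?_ 1)
  simpa [Finsupp.weight_single, leadWeight] using hij

/-- The leading exponent of a product of variables and minors. -/
def leadExp (τ : Fin n → ℕ) (κ : Pair n → ℕ) : Idx n →₀ ℕ :=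
  ∑ t, τ t • Finsupp.single (.inr t) 1 +
    ∑ p, κ p • (Finsupp.single (.inl p.1.1) 1 + Finsupp.single (.inr p.1.2) 1)

theorem hasLead_yMinorProd (τ : Fin n → ℕ) (κ : Pair n → ℕ) :
    HasLead leadWeight (yMinorProd τ κ) (leadExp τ κ) :=
  (HasLead.prod _ fun t _ => (hasLead_X _ (.inr t)).pow (τ t)).mul
    (HasLead.prod _ fun p _ => (hasLead_minor p.2).pow (κ p))

theorem leadExp_inl (τ : Fin n → ℕ) (κ : Pair n → ℕ) (i : Fin n) :
    leadExp τ κ (.inl i) = ∑ p, if p.1.1 = i then κ p else 0 := by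
  simp [leadExp, Finsupp.single_apply]

theorem leadExp_inr (τ : Fin n → ℕ) (κ : Pair n → ℕ) (j : Fin n) :
    leadExp τ κ (.inr j) = τ j + ∑ p, if p.1.2 = j then κ p else 0 := by
  simp [leadExp, Finsupp.single_apply]

theorem leadExp_add_single (τ : Fin n → ℕ) (κ : Pair n → ℕ) (p : Pair n) :
    leadExp τ (κ + Pi.single p 1) =
      leadExp τ κ + (Finsupp.single (.inl p.1.1) 1 + Finsupp.single (.inr p.1.2) 1) := by
  simp only [leadExp, Pi.add_apply, add_smul, Finset.sum_add_distrib, add_assoc]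
  congr 2
  rw [Finset.sum_eq_single p]
  · simp
  · intro q _ hq
    simp [Pi.single_eq_of_ne hq]
  · simp

theorem leadExp_inl_ne_zero {τ : Fin n → ℕ} {κ : Pair n → ℕ} {i : Fin n} :
    leadExp τ κ (.inl i) ≠ 0 ↔ ∃ p, κ p ≠ 0 ∧ p.1.1 = i := by
  rw [leadExp_inl, ne_eq, Finset.sum_eq_zero_iff]
  simp [and_comm]

theorem leadExp_inr_ne_zero {τ : Fin n → ℕ} {κ : Pair n → ℕ} {j : Fin n} :
    leadExp τ κ (.inr j) ≠ 0 ↔ τ j ≠ 0 ∨ ∃ p, κ p ≠ 0 ∧ p.1.2 = j := by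
  rw [leadExp_inr, ne_eq, Nat.add_eq_zero_iff, not_and_or, Finset.sum_eq_zero_iff]
  simp [and_comm]

/-- Some pair starts at the largest `i`, and some pair or variable ends at the largest `j`. Were
these not realised by a single pair `(i, j)`, the two would be strictly nested. -/
theorem Noncrossing.exists_ne_zero_of_max {τ : Fin n → ℕ} {κ : Pair n → ℕ} (h : Noncrossing τ κ)
    {i j : Fin n} (hi : leadExp τ κ (.inl i) ≠ 0)
    (hi' : ∀ i', leadExp τ κ (.inl i') ≠ 0 → i' ≤ i) (hj : leadExp τ κ (.inr j) ≠ 0)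
    (hj' : ∀ j', leadExp τ κ (.inr j') ≠ 0 → j' ≤ j) : ∃ p, κ p ≠ 0 ∧ p.1 = (i, j) := by
  obtain ⟨p, hp, hpi⟩ := leadExp_inl_ne_zero.1 hi
  have hpj : p.1.2 ≤ j := hj' _ (leadExp_inr_ne_zero.2 (.inr ⟨p, hp, rfl⟩))
  rcases hpj.eq_or_lt with heq | hlt
  · exact ⟨p, hp, Prod.ext hpi heq⟩
  rcases leadExp_inr_ne_zero.1 hj with hτ | ⟨q, hq, hqj⟩
  · exact absurd (h.1 p j hlt) (mul_ne_zero hp hτ)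
  · have hqi : q.1.1 ≤ i := hi' _ (leadExp_inl_ne_zero.2 ⟨q, hq, rfl⟩)
    rcases hqi.eq_or_lt with heq | hlt'
    · exact ⟨q, hq, Prod.ext heq hqj⟩
    · exact absurd (h.2 q p (hpi ▸ hlt') (hqj ▸ hlt)) (mul_ne_zero hq hp)

theorem Noncrossing.of_add {τ : Fin n → ℕ} {κ κ' : Pair n → ℕ} (h : Noncrossing τ (κ + κ')) :
    Noncrossing τ κ := by
  refine ⟨fun p t hpt => ?_, fun p q h1 h2 => ?_⟩
  · have := h.1 p t hpt
    simp only [Pi.add_apply, mul_eq_zero] at this ⊢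
    omega
  · have := h.2 p q h1 h2
    simp only [Pi.add_apply, mul_eq_zero] at this ⊢
    omega

/-- The pair of largest indices is visible in the leading exponent, so it occurs on both sides; it
is cancelled, and the induction runs on the number of minors. -/
theorem leadExp_injective (N : ℕ) : ∀ {τ τ' : Fin n → ℕ} {κ κ' : Pair n → ℕ}, ∑ p, κ p = N →
    Noncrossing τ κ → Noncrossing τ' κ' → leadExp τ κ = leadExp τ' κ' → τ = τ' ∧ κ = κ' := by
  induction N with
  | zero =>
    intro τ τ' κ κ' hN h h' heq
    have hκ : κ = 0 := funext fun p => Finset.sum_eq_zero_iff.1 hN p (Finset.mem_univ p)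
    have hκ' : κ' = 0 := by
      by_contra hne
      obtain ⟨p, hp⟩ := Function.ne_iff.1 hne
      have h1 := leadExp_inl_ne_zero (τ := τ').2 ⟨p, hp, rfl⟩
      rw [← heq, leadExp_inl_ne_zero, hκ] at h1
      obtain ⟨q, hq, _⟩ := h1
      exact hq rfl
    refine ⟨funext fun t => ?_, hκ.trans hκ'.symm⟩
    have h1 := DFunLike.congr_fun heq (Sum.inr t)
    simpa [leadExp_inr, hκ, hκ'] using h1
  | succ N ih =>
    intro τ τ' κ κ' hN h h' heq
    obtain ⟨q, -, hq⟩ := Finset.exists_ne_zero_of_sum_ne_zero (hN.trans_ne (Nat.succ_ne_zero N))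
    have hmax (g : Fin n → ℕ) (hg : ∃ i, g i ≠ 0) : ∃ i, g i ≠ 0 ∧ ∀ i', g i' ≠ 0 → i' ≤ i := by
      obtain ⟨i, hi⟩ := hg
      obtain ⟨m, hm, hm'⟩ := Finset.exists_max_image (Finset.univ.filter fun i => g i ≠ 0) id
        ⟨i, by simpa using hi⟩
      exact ⟨m, by simpa using hm, fun i' hi' => hm' i' (by simpa using hi')⟩
    obtain ⟨i, hi, hi'⟩ := hmax (fun i => leadExp τ κ (.inl i))
      ⟨_, leadExp_inl_ne_zero.2 ⟨q, hq, rfl⟩⟩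
    obtain ⟨j, hj, hj'⟩ := hmax (fun i => leadExp τ κ (.inr i))
      ⟨_, leadExp_inr_ne_zero.2 (.inr ⟨q, hq, rfl⟩)⟩
    obtain ⟨p, hp, hpij⟩ := h.exists_ne_zero_of_max hi hi' hj hj'
    simp only [heq] at hi hi' hj hj'
    obtain ⟨p', hp', hpij'⟩ := h'.exists_ne_zero_of_max hi hi' hj hj'
    obtain rfl : p = p' := Subtype.ext (hpij.trans hpij'.symm)
    obtain ⟨κ, rfl⟩ := exists_eq_add_single hp
    obtain ⟨κ', rfl⟩ := exists_eq_add_single hp'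
    rw [leadExp_add_single, leadExp_add_single] at heq
    obtain ⟨h1, h2⟩ := ih (by simpa [Finset.sum_add_distrib] using hN) h.of_add h'.of_add
      (add_right_cancel heq)
    exact ⟨h1, by rw [h2]⟩

theorem linearIndependent_basisη (k : ℤ) :
    LinearIndependent ℂ (basisη : NoncrossingExp n k → Poly n) := by
  refine linearIndependent_of_hasLead (w := leadWeight) (α := fun e => leadExp e.1.1 e.1.2) ?_
    fun e => hasLead_yMinorProd e.1.1 e.1.2
  intro e e' h
  obtain ⟨h1, h2⟩ := leadExp_injective _ rfl e.2.2 e'.2.2 h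
  exact Subtype.ext (Prod.ext h1 h2)

/-! ### Submodules for `so(2n, ℂ)` -/

theorem mem_so_iff {M : Gl n} : M ∈ so n ↔ ∀ a b, M a b = -M b.swap a.swap := by
  have hJ (a b : Idx n) : LieAlgebra.Orthogonal.JD (Fin n) ℂ a b = if a.swap = b then 1 else 0 := by
    rcases a with i | i <;> rcases b with j | j <;>
      simp [LieAlgebra.Orthogonal.JD, Matrix.one_apply]
  have h1 (a b : Idx n) : (M.transpose * LieAlgebra.Orthogonal.JD (Fin n) ℂ) a b = M b.swap a := by
    simp only [Matrix.mul_apply, hJ, Matrix.transpose_apply]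
    rw [Finset.sum_eq_single b.swap]
    · simp
    · intro c _ hc
      rw [if_neg (fun h => hc (by rw [← h, Sum.swap_swap])), mul_zero]
    · simp
  have h2 (a b : Idx n) : (LieAlgebra.Orthogonal.JD (Fin n) ℂ * -M) a b = -M a.swap b := by
    simp only [Matrix.mul_apply, hJ, Matrix.neg_apply]
    simp
  change M ∈ skewAdjointMatricesLieSubalgebra _ ↔ _
  rw [mem_skewAdjointMatricesLieSubalgebra, mem_skewAdjointMatricesSubmodule]
  change M.transpose * _ = _ * -M ↔ _
  constructor
  · intro h a b
    have := congrFun (congrFun h b) a.swap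
    rw [h1, h2, Sum.swap_swap] at this
    rw [this]
  · intro h
    ext a b
    rw [h1, h2, h, Sum.swap_swap]

/-- The matrices spanning `so(2n, ℂ)`. -/
def soElt (a b : Idx n) : Gl n := E a b - E b.swap a.swap

theorem soElt_mem (a b : Idx n) : soElt a b ∈ so n := by
  rw [mem_so_iff]
  intro c d
  have h (x y : Idx n) : x.swap = y ↔ x = y.swap :=
    ⟨fun h => by rw [← h, Sum.swap_swap], fun h => by rw [h, Sum.swap_swap]⟩
  simp only [soElt, E, Matrix.sub_apply, Matrix.single_apply, neg_sub, h, Sum.swap_swap,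
    and_comm]

theorem lie_soElt (a b : Idx n) (f : Poly n) :
    ⁅soElt a b, f⁆ = opE a b f - opE b.swap a.swap f := by
  rw [soElt, sub_lie, lie_E, lie_E]

theorem opE_sub_inl_inl (i j : Fin n) (f : Poly n) :
    opE (.inl i) (.inl j) f - opE (.inr j) (.inr i) f = -opL i j f - (if i = j then f else 0) := by
  have h : (if i = j then (1 : Module.End ℂ (Poly n)) else 0) f = if i = j then f else 0 := by
    split_ifs <;> rfl
  simp only [opE, opL, LinearMap.sub_apply, LinearMap.neg_apply, LinearMap.add_apply, h]
  abel

theorem opE_sub_inl_inr (i j : Fin n) (f : Poly n) :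
    opE (.inl i) (.inr j) f - opE (.inl j) (.inr i) f = opD i j f := rfl

theorem opE_sub_inr_inl (i j : Fin n) (f : Poly n) :
    opE (.inr i) (.inl j) f - opE (.inr j) (.inl i) f = opM i j f := by
  simp only [opE, opM, LinearMap.sub_apply, LinearMap.neg_apply, mulX_comm (.inl i),
    mulX_comm (.inl j)]
  abel

theorem Stable.opE_sub_mem {S : Submodule ℂ (Poly n)} (hS : Stable S) {f : Poly n} (hf : f ∈ S)
    (a b : Idx n) : opE a b f - opE b.swap a.swap f ∈ S := by
  have hll (i j : Fin n) : opE (.inl i) (.inl j) f - opE (.inr j) (.inr i) f ∈ S := by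
    rw [opE_sub_inl_inl]
    refine S.sub_mem (S.neg_mem (hS.opL_mem i j f hf)) ?_
    split_ifs
    exacts [hf, S.zero_mem]
  rcases a with i | i <;> rcases b with j | j
  · exact hll i j
  · exact hS.opD_mem i j f hf
  · change opE (.inr i) (.inl j) f - opE (.inr j) (.inl i) f ∈ S
    rw [opE_sub_inr_inl]
    exact hS.opM_mem i j f hf
  · change opE (.inr i) (.inr j) f - opE (.inl j) (.inl i) f ∈ S
    rw [← neg_sub]
    exact S.neg_mem (hll j i)

/-- The symmetry of the entries of `M` lets the action be averaged with its reflection, so that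
twice it is a combination of the operators of `soElt a b`. No spanning set of `so(2n, ℂ)` has to be
exhibited. -/
theorem Stable.lie_mem {S : Submodule ℂ (Poly n)} (hS : Stable S) {M : Gl n} (hM : M ∈ so n)
    {f : Poly n} (hf : f ∈ S) : ⁅M, f⁆ ∈ S := by
  have h1 : ⁅M, f⁆ = ∑ a, ∑ b, M a b • opE a b f := by
    change repLin n M f = _
    simp only [repLin, LinearMap.coe_mk, AddHom.coe_mk, LinearMap.sum_apply, LinearMap.smul_apply]
  have h2 : ⁅M, f⁆ = -∑ a, ∑ b, M a b • opE b.swap a.swap f := by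
    rw [h1, Finset.sum_comm, ← Finset.sum_neg_distrib,
      ← Equiv.sum_comp (Equiv.sumComm (Fin n) (Fin n))]
    refine Finset.sum_congr rfl fun a _ => ?_
    rw [← Finset.sum_neg_distrib, ← Equiv.sum_comp (Equiv.sumComm (Fin n) (Fin n))]
    refine Finset.sum_congr rfl fun b _ => ?_
    rw [← neg_smul]
    change M b.swap a.swap • _ = _
    rw [mem_so_iff.1 hM b.swap a.swap, Sum.swap_swap, Sum.swap_swap]
    rfl
  have h3 : (2 : ℂ) • ⁅M, f⁆ = ∑ a, ∑ b, M a b • (opE a b f - opE b.swap a.swap f) := by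
    rw [two_smul]
    nth_rewrite 1 [h1]
    rw [h2, ← sub_eq_add_neg]
    simp only [smul_sub, Finset.sum_sub_distrib]
  rw [← S.smul_mem_iff (two_ne_zero (α := ℂ)), h3]
  exact S.sum_mem fun a _ => S.sum_mem fun b _ => S.smul_mem _ (hS.opE_sub_mem hf a b)

/-- A stable subspace as a Lie submodule. -/
def Stable.toLieSubmodule {S : Submodule ℂ (Poly n)} (hS : Stable S) :
    LieSubmodule ℂ (so n) (Poly n) :=
  { S with lie_mem := fun {x _} hm => hS.lie_mem x.2 hm }

theorem stable_lieSubmodule (N : LieSubmodule ℂ (so n) (Poly n)) : Stable N.toSubmodule := by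
  have h (a b : Idx n) {f : Poly n} (hf : f ∈ N) :
      opE a b f - opE b.swap a.swap f ∈ N.toSubmodule := by
    rw [← lie_soElt]
    exact N.lie_mem (x := ⟨_, soElt_mem a b⟩) hf
  refine ⟨fun i j f hf => ?_, fun i j f hf => h (.inl i) (.inr j) hf, fun i j f hf => ?_⟩
  · have h1 := h (.inl i) (.inl j) hf
    simp only [Sum.swap_inl, opE_sub_inl_inl] at h1
    have h2 : (if i = j then f else 0) ∈ N.toSubmodule := by
      split_ifs
      exacts [hf, N.toSubmodule.zero_mem]
    have h3 := N.toSubmodule.neg_mem (N.toSubmodule.add_mem h1 h2)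
    rwa [sub_add_cancel, neg_neg] at h3
  · have h1 := h (.inr i) (.inl j) hf
    simp only [Sum.swap_inl, Sum.swap_inr, opE_sub_inr_inl] at h1
    exact h1

/-! ### Highest weight vectors -/

theorem lie_cartanElt (i : Fin n) (f : Poly n) : ⁅cartanElt i, f⁆ = -opL i i f - f := by
  rw [cartanElt, sub_lie, lie_E, lie_E, opE_sub_inl_inl, if_pos rfl]

theorem lie_cartan {v : Poly n} {μ : Module.Dual ℂ (cartan n)}
    (h : ∀ (i : Fin n) (hi : cartanElt i ∈ cartan n), -opL i i v - v = μ ⟨cartanElt i, hi⟩ • v)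
    (x : cartan n) : ⁅(x : Gl n), v⁆ = μ x • v := by
  obtain ⟨x, hx⟩ := x
  induction hx using Submodule.span_induction with
  | mem x hx =>
    obtain ⟨i, rfl⟩ := hx
    rw [lie_cartanElt]
    exact h i _
  | zero =>
    have h0 : μ (0 : cartan n) = 0 := map_zero μ
    rw [zero_lie]
    exact ((congrArg (· • v) h0).trans (zero_smul _ _)).symm
  | add x y hx hy ihx ihy =>
    have h0 := map_add μ ⟨x, hx⟩ ⟨y, hy⟩
    simp only at ihx ihy
    rw [add_lie, ihx, ihy, ← add_smul, ← h0]
    rfl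
  | smul c x hx ihx =>
    have h0 := map_smul μ c ⟨x, hx⟩
    simp only at ihx
    rw [smul_lie, ihx, smul_smul, ← smul_eq_mul, ← h0]
    rfl

theorem lie_posPart {v : Poly n} (hL : ∀ i j, i < j → opL i j v = 0) (hD : ∀ i j, opD i j v = 0)
    (M : Gl n) (hM : M ∈ posPart n) : ⁅M, v⁆ = 0 := by
  induction hM using Submodule.span_induction with
  | mem M hM =>
    obtain ⟨i, j, hij, rfl | rfl⟩ := hM
    · rw [sub_lie, lie_E, lie_E, opE_sub_inl_inl, hL i j hij, if_neg hij.ne, neg_zero, sub_zero]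
    · rw [sub_lie, lie_E, lie_E, opE_sub_inl_inr, hD]
  | zero => exact zero_lie v
  | add x y _ _ hx hy => rw [add_lie, hx, hy, add_zero]
  | smul c x _ hx => rw [smul_lie, hx, smul_zero]

/-- In terms of the `ε_j` the weight is `-∑ ε_j - K ε_n`; the first term reflects the constants
`-δ_{i,j}` in the representation. -/
theorem weight_cartanElt {a l : Fin n} (ha : a.1 + 2 = n) (hl : l.1 + 1 = n) (K : ℂ) (i : Fin n) (hi : cartanElt i ∈ cartan n) :
    (K • fundWeight a - (K + 2) • fundWeight l :
      Module.Dual ℂ (cartan n)) ⟨cartanElt i, hi⟩ =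
      -(if i = l then K else 0) - 1 := by
  have h1 : fundWeight a = (2⁻¹ : ℂ) • (∑ j, eps j) - eps l := by
    have e : (⟨a.1 + 1, by omega⟩ : Fin n) = l := Fin.ext (by simp only; omega)
    rw [fundWeight, if_neg (by omega), dif_pos ha, e]
  have h2 : fundWeight l = (2⁻¹ : ℂ) • (∑ j, eps j) := by
    rw [fundWeight, if_neg (by omega), dif_neg (by omega)]
  rw [h1, h2]
  simp only [LinearMap.sub_apply, LinearMap.smul_apply, LinearMap.sum_apply, eps_cartanElt,
    Finset.sum_ite_eq', Finset.mem_univ, if_true, smul_eq_mul, eq_comm (a := i)]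
  split_ifs <;> ring

/-- Kept abstract in `W`, `v` and `K` to serve both signs of `k`, with `K = |k|`. Irreducibility
combines `hmin` and `hgen`: a nonzero submodule contains `v`, and `v` generates `W`. -/
theorem isHighestWeight_of_stable {a l : Fin n} (ha : a.1 + 2 = n) (hl : l.1 + 1 = n)
    {W : Submodule ℂ (Poly n)} {v : Poly n} {K : ℂ}
    (hW : Stable W) (hv0 : v ≠ 0) (hvW : v ∈ W)
    (hL : ∀ i j, i < j → opL i j v = 0) (hD : ∀ i j, opD i j v = 0)
    (hC : ∀ i : Fin n, opL i i v = (if i = l then K else 0) • v)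
    (hmin : ∀ S, Stable S → S ≤ W → S ≠ ⊥ → v ∈ S) (hgen : ∀ S, Stable S → v ∈ S → W ≤ S) :
    ∃ N : LieSubmodule ℂ (so n) (Poly n), N.toSubmodule = W ∧
      LieModule.IsIrreducible ℂ (so n) N ∧
      IsHighestWeight N
        (K • fundWeight a - (K + 2) • fundWeight l) v := by
  refine ⟨hW.toLieSubmodule, rfl, ?_, hv0, ?_, lie_posPart hL hD, ?_⟩
  · have : Nontrivial hW.toLieSubmodule :=
      ⟨⟨⟨v, hvW⟩, 0, fun h => hv0 (congrArg Subtype.val h)⟩⟩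
    refine LieModule.IsIrreducible.mk fun L hL0 => ?_
    have hst := stable_lieSubmodule (L.map hW.toLieSubmodule.incl)
    have hle : (L.map hW.toLieSubmodule.incl).toSubmodule ≤ W := by
      rintro _ ⟨x, _, rfl⟩
      exact x.2
    have hne : (L.map hW.toLieSubmodule.incl).toSubmodule ≠ ⊥ := by
      intro h
      refine hL0 ((LieSubmodule.eq_bot_iff _).2 fun x hx => ?_)
      have hx' : (x : Poly n) ∈ (L.map hW.toLieSubmodule.incl).toSubmodule := ⟨x, hx, rfl⟩
      rw [h, Submodule.mem_bot] at hx'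
      exact Subtype.ext hx'
    refine eq_top_iff.2 fun x _ => ?_
    obtain ⟨y, hy, hyx⟩ := hgen _ hst (hmin _ hst hle hne) x.2
    have : y = x := Subtype.ext hyx
    exact this ▸ hy
  · refine lie_cartan fun i hi => ?_
    rw [weight_cartanElt ha hl, hC, sub_smul, neg_smul, one_smul]
  · apply le_antisymm
    · rw [LieSubmodule.lieSpan_le]
      exact Set.singleton_subset_iff.2 hvW
    · exact hgen _ (stable_lieSubmodule _) (LieSubmodule.subset_lieSpan (Set.mem_singleton v))

theorem dX_X_pow_of_ne {a b : Idx n} (h : b ≠ a) (m : ℕ) :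
    dX a (MvPolynomial.X b ^ m) = 0 := by
  rw [dX_apply, MvPolynomial.pderiv_pow, MvPolynomial.pderiv_X_of_ne h, mul_zero]

theorem opL_X_inr_pow_of_ne {i j l : Fin n} (h : i ≠ l) (m : ℕ) :
    opL i j (MvPolynomial.X (.inr l) ^ m) = 0 := by
  rw [opL, LinearMap.add_apply, Module.End.mul_apply, Module.End.mul_apply,
    dX_X_pow_of_ne (by simp), dX_X_pow_of_ne (by simpa using h.symm), map_zero, map_zero, add_zero]

theorem opL_X_inr_pow_self (l : Fin n) (m : ℕ) :
    opL l l (MvPolynomial.X (.inr l) ^ m) = (m : ℂ) • MvPolynomial.X (.inr l) ^ m := by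
  rw [opL, LinearMap.add_apply, Module.End.mul_apply, Module.End.mul_apply,
    dX_X_pow_of_ne (by simp), map_zero, zero_add, dX_apply, MvPolynomial.pderiv_pow,
    MvPolynomial.pderiv_X_self, mulX_apply, MvPolynomial.smul_eq_C_mul, map_natCast, mul_one]
  rcases m with _ | m
  · simp
  · rw [Nat.add_sub_cancel, pow_succ]
    ring

theorem opD_X_inr_pow (i j l : Fin n) (m : ℕ) :
    opD i j (MvPolynomial.X (.inr l) ^ m) = 0 := by
  rw [opD, dX_comm (.inl i), dX_comm (.inl j), LinearMap.sub_apply, Module.End.mul_apply,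
    Module.End.mul_apply, dX_X_pow_of_ne (by simp), dX_X_pow_of_ne (by simp), map_zero, map_zero,
    sub_zero]

theorem X_inr_pow_mem_kerη {k : ℤ} (hk : 0 ≤ k) (l : Fin n) :
    MvPolynomial.X (.inr l) ^ k.toNat ∈ kerη n k := by
  have h := pow_mem_kerη (X_inr_mem_kerη l) k.toNat
  rwa [Int.toNat_of_nonneg hk, mul_one] at h

theorem X_pow_ne_zero (a : Idx n) (m : ℕ) : (MvPolynomial.X a : Poly n) ^ m ≠ 0 :=
  pow_ne_zero _ (MvPolynomial.X_ne_zero _)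

theorem ne_of_lt_last {l i j : Fin n} (hl : l.1 + 1 = n) (h : i < j) : i ≠ l := by
  rintro rfl
  have := Fin.lt_def.1 h
  omega

theorem kerη_isHighestWeight {a l : Fin n} (ha : a.1 + 2 = n) (hl : l.1 + 1 = n)
    {k : ℤ} (hk : 0 ≤ k) :
    ∃ N : LieSubmodule ℂ (so n) (Poly n), N.toSubmodule = kerη n k ∧
      LieModule.IsIrreducible ℂ (so n) N ∧
      IsHighestWeight N
        ((k : ℂ) • fundWeight a - ((k : ℂ) + 2) • fundWeight l)
        (MvPolynomial.X (.inr l) ^ k.toNat) := by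
  have hkC : ((k.toNat : ℕ) : ℂ) = k := by exact_mod_cast congrArg (Int.cast (R := ℂ)) (Int.toNat_of_nonneg hk)
  refine isHighestWeight_of_stable ha hl (stable_kerη k) (X_pow_ne_zero _ _)
    (X_inr_pow_mem_kerη hk _) (fun i j hij => opL_X_inr_pow_of_ne (ne_of_lt_last hl hij) _)
    (fun i j => opD_X_inr_pow i j _ _) (fun i => ?_)
    (fun S hS hle h0 => X_pow_mem_of_stable _ hS hle h0)
    (fun S hS hv => kerη_le_of_stable hk _ hS hv)
  split_ifs with h
  · rw [h, opL_X_inr_pow_self, hkC]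
  · rw [opL_X_inr_pow_of_ne h, zero_smul]

theorem kerΔ_isHighestWeight {a l : Fin n} (ha : a.1 + 2 = n) (hl : l.1 + 1 = n)
    {k : ℤ} (hk : k < 0) :
    ∃ N : LieSubmodule ℂ (so n) (Poly n), N.toSubmodule = kerΔ n k ∧
      LieModule.IsIrreducible ℂ (so n) N ∧
      IsHighestWeight N
        (-(k : ℂ) • fundWeight a + ((k : ℂ) - 2) • fundWeight l)
        (MvPolynomial.X (.inl l) ^ (-k).toNat) := by
  have hk' : 0 ≤ -k := by omega
  have hkC : (((-k).toNat : ℕ) : ℂ) = -k := by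
    exact_mod_cast congrArg (Int.cast (R := ℂ)) (Int.toNat_of_nonneg hk')
  have hv : MvPolynomial.X (.inl l) ^ (-k).toNat =
      swapXY n (MvPolynomial.X (.inr l) ^ (-k).toNat) := by
    rw [map_pow, swapXY_X, Sum.swap_inr]
  have hcc (S : Submodule ℂ (Poly n)) (f : Poly n) :
      swapXY n f ∈ S.comap (swapLin n).toLinearMap ↔ f ∈ S := by
    change swapXY n (swapXY n f) ∈ S ↔ _
    rw [swapXY_swapXY]
  have hw : (-(k : ℂ) • fundWeight a + ((k : ℂ) - 2) • fundWeight l :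
      Module.Dual ℂ (cartan n)) =
      (-(k : ℂ)) • fundWeight a - (-(k : ℂ) + 2) • fundWeight l := by
    rw [show (k : ℂ) - 2 = -(-(k : ℂ) + 2) by ring, neg_smul (-(k : ℂ) + 2)]
    exact (sub_eq_add_neg _ _).symm
  rw [hw, hv, ← comap_swap_kerη]
  refine isHighestWeight_of_stable ha hl (stable_kerη (-k)).comap_swap
    (by rw [← hv]; exact X_pow_ne_zero _ _)
    ((hcc _ _).2 (X_inr_pow_mem_kerη hk' _)) (fun i j hij => ?_) (fun i j => ?_) (fun i => ?_)
    (fun S hS hle h0 => ?_) (fun S hS hvS => ?_)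
  · rw [← swapXY_opL, opL_X_inr_pow_of_ne (ne_of_lt_last hl hij), map_zero]
  · rw [← neg_neg (opD i j _), ← swapXY_opD, opD_X_inr_pow, map_zero, neg_zero]
  · rw [← swapXY_opL]
    split_ifs with h
    · rw [h, opL_X_inr_pow_self, hkC, map_smul]
    · rw [opL_X_inr_pow_of_ne h, map_zero, zero_smul]
  -- The exchange is an involution, so `S` is replaced by its preimage, a nonzero stable subspace of
  -- `kerη n (-k)`.
  · refine X_pow_mem_of_stable l hS.comap_swap (fun f hf => ?_) (fun h => h0 ?_)
    · have := hle hf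
      change swapXY n (swapXY n f) ∈ kerη n (-k) at this
      rwa [swapXY_swapXY] at this
    · rw [eq_bot_iff]
      intro f hf
      have h1 : swapXY n f ∈ S.comap (swapLin n).toLinearMap := (hcc S f).2 hf
      rw [h, Submodule.mem_bot, EmbeddingLike.map_eq_zero_iff] at h1
      exact h1
  · intro f hf
    have := kerη_le_of_stable hk' l hS.comap_swap hvS hf
    change swapXY n (swapXY n f) ∈ S at this
    rwa [swapXY_swapXY] at this

/-! ### The results for negative degree -/

theorem disjoint_kerΔ_mapη {k : ℤ} (hk : k < 0) :
    Disjoint (kerΔ n k) ((gradedPiece n (k - 2)).map (η n)) := by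
  have h := disjoint_kerη_mapΔ (n := n) (k := -k) (by omega)
  rw [← comap_swap_kerη, ← comap_swap_mapΔ, Submodule.disjoint_def]
  rw [Submodule.disjoint_def] at h
  intro f h1 h2
  exact (swapLin n).map_eq_zero_iff.1 (h _ h1 h2)

theorem kerΔ_sup_mapη {k : ℤ} (hk : k < 0) :
    kerΔ n k ⊔ (gradedPiece n (k - 2)).map (η n) = gradedPiece n k := by
  have h := kerη_sup_mapΔ (n := n) (k := -k) (by omega)
  rw [← comap_swap_kerη, ← comap_swap_mapΔ, ← comap_swap_gradedPiece k, ← h]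
  simp only [Submodule.comap_equiv_eq_map_symm, Submodule.map_sup]

/-- Each minor changes sign, so the two families correspond up to signs. The signs are taken in `ℂˣ`
so that rescaling by units preserves linear independence. -/
theorem swapXY_basisη {d : ℤ} (e : NoncrossingExp n d) :
    swapXY n (basisη e) = ((-1 : ℂˣ) ^ ∑ p, e.1.2 p) • basisΔ e := by
  have h (p : Pair n) : swapXY n (minor p.1.1 p.1.2 ^ e.1.2 p) =
      (-1) ^ e.1.2 p * minor p.1.1 p.1.2 ^ e.1.2 p := by
    rw [map_pow, swapXY_minor, ← neg_one_mul, mul_pow]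
  have h2 : swapXY n (minorProd e.1.2) = (-1) ^ (∑ p, e.1.2 p) * minorProd e.1.2 := by
    change swapXY n (∏ p : Pair n, minor p.1.1 p.1.2 ^ e.1.2 p) = _
    rw [map_prod, Finset.prod_congr rfl fun p _ => h p, Finset.prod_mul_distrib,
      Finset.prod_pow_eq_pow_sum]
    rfl
  rw [basisη, map_mul, h2, map_prod, Units.smul_def, MvPolynomial.smul_eq_C_mul, basisΔ]
  simp only [map_pow, swapXY_X, Sum.swap_inr, Units.val_pow_eq_pow_val, Units.val_neg,
    Units.val_one, map_neg, map_one]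
  ring

theorem basisΔ_eq_smul {d : ℤ} (e : NoncrossingExp n d) :
    basisΔ e = ((-1 : ℂˣ) ^ ∑ p, e.1.2 p)⁻¹ • swapXY n (basisη e) := by
  rw [swapXY_basisη, inv_smul_smul]

theorem linearIndependent_basisΔ (d : ℤ) :
    LinearIndependent ℂ (basisΔ : NoncrossingExp n d → Poly n) := by
  have h1 := (linearIndependent_basisη (n := n) d).map' (swapLin n).toLinearMap (swapLin n).ker
  have h2 := h1.units_smul fun e : NoncrossingExp n d => ((-1 : ℂˣ) ^ ∑ p, e.1.2 p)⁻¹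
  rw [show (basisΔ : NoncrossingExp n d → Poly n) = _ from funext fun e => basisΔ_eq_smul e]
  exact h2

theorem span_basisΔ {k : ℤ} (hk : k < 0) :
    Submodule.span ℂ (Set.range (basisΔ : NoncrossingExp n (-k) → Poly n)) = kerΔ n k := by
  have hη := span_basisη (n := n) (k := -k) (by omega)
  apply le_antisymm
  · refine Submodule.span_le.2 ?_
    rintro _ ⟨e, rfl⟩
    rw [basisΔ_eq_smul, Units.smul_def, ← comap_swap_kerη]
    refine Submodule.smul_mem _ _ ?_
    change swapXY n (swapXY n (basisη e)) ∈ kerη n (-k)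
    rw [swapXY_swapXY]
    exact basisη_mem_kerη e
  · rw [← comap_swap_kerη, ← hη]
    intro f hf
    have h : Submodule.span ℂ (Set.range (basisη : NoncrossingExp n (-k) → Poly n)) ≤
        (Submodule.span ℂ (Set.range (basisΔ : NoncrossingExp n (-k) → Poly n))).comap
          (swapLin n).toLinearMap := by
      refine Submodule.span_le.2 ?_
      rintro _ ⟨e, rfl⟩
      change swapXY n (basisη e) ∈ Submodule.span ℂ _
      rw [swapXY_basisη, Units.smul_def]
      exact Submodule.smul_mem _ _ (Submodule.subset_span ⟨e, rfl⟩)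
    have h1 := h hf
    change swapXY n (swapXY n f) ∈ Submodule.span ℂ _ at h1
    rwa [swapXY_swapXY] at h1

end

end SoPoly

open SoPoly in
theorem theorem3p3 (n : ℕ) (hn : 2 ≤ n) (k : ℤ) :
    (0 ≤ k →
      -- the direct sum decomposition
      (Disjoint (kerη n k) ((gradedPiece n (k + 2)).map (Δ n)) ∧
        kerη n k ⊔ (gradedPiece n (k + 2)).map (Δ n) = gradedPiece n k) ∧
      -- the second summand is a submodule for `so(2n, ℂ)`
      (∃ D : LieSubmodule ℂ (so n) (Poly n),
        D.toSubmodule = (gradedPiece n (k + 2)).map (Δ n)) ∧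
      -- the first one is an irreducible highest weight module
      (∃ N : LieSubmodule ℂ (so n) (Poly n), N.toSubmodule = kerη n k ∧
        LieModule.IsIrreducible ℂ (so n) N ∧
        IsHighestWeight N
          ((k : ℂ) • fundWeight ⟨n - 2, by omega⟩ - ((k : ℂ) + 2) • fundWeight ⟨n - 1, by omega⟩)
          (MvPolynomial.X (Sum.inr ⟨n - 1, by omega⟩) ^ k.toNat)) ∧
      -- the basis
      LinearIndependent ℂ (basisη : NoncrossingExp n k → Poly n) ∧
      Submodule.span ℂ (Set.range (basisη : NoncrossingExp n k → Poly n)) = kerη n k) ∧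
    (k < 0 →
      (Disjoint (kerΔ n k) ((gradedPiece n (k - 2)).map (η n)) ∧
        kerΔ n k ⊔ (gradedPiece n (k - 2)).map (η n) = gradedPiece n k) ∧
      (∃ D : LieSubmodule ℂ (so n) (Poly n),
        D.toSubmodule = (gradedPiece n (k - 2)).map (η n)) ∧
      (∃ N : LieSubmodule ℂ (so n) (Poly n), N.toSubmodule = kerΔ n k ∧
        LieModule.IsIrreducible ℂ (so n) N ∧
        IsHighestWeight N
          (-(k : ℂ) • fundWeight ⟨n - 2, by omega⟩ + ((k : ℂ) - 2) • fundWeight ⟨n - 1, by omega⟩)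
          (MvPolynomial.X (Sum.inl ⟨n - 1, by omega⟩) ^ (-k).toNat)) ∧
      LinearIndependent ℂ (basisΔ : NoncrossingExp n (-k) → Poly n) ∧
      Submodule.span ℂ (Set.range (basisΔ : NoncrossingExp n (-k) → Poly n)) = kerΔ n k) := by
  exact ⟨fun hk => ⟨⟨disjoint_kerη_mapΔ hk, kerη_sup_mapΔ hk⟩,
      ⟨(stable_mapΔ _).toLieSubmodule, rfl⟩, kerη_isHighestWeight (Nat.sub_add_cancel hn)
        (Nat.sub_add_cancel (Nat.le_of_succ_le hn)) hk,
      linearIndependent_basisη k, span_basisη hk⟩,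
    fun hk => ⟨⟨disjoint_kerΔ_mapη hk, kerΔ_sup_mapη hk⟩,
      ⟨(stable_mapη _).toLieSubmodule, rfl⟩, kerΔ_isHighestWeight (Nat.sub_add_cancel hn)
        (Nat.sub_add_cancel (Nat.le_of_succ_le hn)) hk,
      linearIndependent_basisΔ (-k), span_basisΔ hk⟩⟩
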